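/- Let $f:\mathbb{R}^2\to\mathbb{R}$ be convex and differentiable, and suppose that for every $\alpha\in\mathbb{R}$ the level set $\{x\in\mathbb{R}^2: f(x)\le\alpha\}$ is bounded. Consider the problem $\min\{f(z): z\in\mathbb{Z}^2\}$. **Definitions.** For a non-empty finite set $\mathcal{X}\subseteq\mathbb{Z}^2$ put $\operatorname{GP}(\mathcal{X})=\{y\in\mathbb{R}^2:\nabla f(w)^\top(y-w)\le 0\ \forall w\in\mathcal{X}\}$, and let $\operatorname{intr}(\operatorname{GP}(\mathcal{X}))$ be the set defined by the same inequalities with $<$ in place of $\le$. A vector $a$ *strictly cuts* $b$ if $\nabla f(a)^\top(b-a)>0$. A set $\mathcal{U}\subseteq\mathbb{Z}^2$ is *unimodular* if $\mathcal{U}=\mathcal{U}(z,U):=\{z+Ue: e\in\{0,1\}^2\}$ for some $z\in\mathbb{Z}^2$ and some $U=(u^1,u^2)\in\mathbb{Z}^{2\times 2}$ with $|\det U|=1$; the pair $(z,U)$ is then called a labelling of $\mathcal{U}$. A labelling is *preprocessed* if 1. $z\in\operatorname{GP}(\mathcal{U})$; 2. if $|\mathcal{U}\cap\operatorname{GP}(\mathcal{U})|=2$,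 then either $\mathcal{U}\cap\operatorname{GP}(\mathcal{U})=\{z,z+u^1\}$, or $\mathcal{U}\cap\operatorname{GP}(\mathcal{U})=\{z,z+u^1+u^2\}$, $z$ strictly cuts $z+u^1$, and $z+u^1+u^2$ strictly cuts $z+u^2$; 3. if $|\mathcal{U}\cap\operatorname{GP}(\mathcal{U})|=3$, then $\mathcal{U}\cap\operatorname{GP}(\mathcal{U})=\{z,z+u^1,z+u^2\}$. A unimodular set $\mathcal{U}$ is *connected* if it has a preprocessed labelling with $\{z,z+u^1\}\subseteq\mathcal{U}\cap\operatorname{GP}(\mathcal{U})$. For a labelling $(z,U)$ of $\mathcal U$ and $i\in\{-1,1\}$ put $H^i=\{z+ku^1+iu^2\in\operatorname{intr}(\operatorname{GP}(\mathcal{U})): k\in\mathbb{R}\}$. **Table.** For a preprocessed labelling $(z,U)$ of $\mathcal{U}$, the matrix $\operatorname{Flip}(U)$ is given by the following cases. * Case 1: $\mathcal{U}\cap\operatorname{GP}(\mathcal{U})=\{z\}$. Then $\operatorname{Flip}(U)=(\sigma^1u^1,\sigma^2u^2)$, where $\sigma^j=1$ if $\nabla f(z)^\top u^j\le 0$ and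 $\sigma^j=-1$ otherwise. * Case 2: $\mathcal{U}\cap\operatorname{GP}(\mathcal{U})=\{z,z+u^1+u^2\}$. Put $U'=(u^1,u^1+u^2)$, $\mathcal{U}'=\mathcal{U}(z,U')$, $U''=(-u^1,u^1+u^2)$, $\mathcal{U}''=\mathcal{U}(z,U'')$. If $\mathcal{U}'$ is connected, or $\mathcal{U}'\cap\operatorname{GP}(\mathcal{U}')=\{z+2u^1+u^2\}$, or $z+u^1+u^2$ strictly cuts $z-u^1$ and $z-u^1$ strictly cuts $z$, then $\operatorname{Flip}(U)=U'$. Else, if $\mathcal{U}''$ is connected, or $\mathcal{U}''\cap\operatorname{GP}(\mathcal{U}'')=\{z-u^1\}$, or $z$ strictly cuts $z+2u^1+u^2$ and $z+2u^1+u^2$ strictly cuts $z+u^1+u^2$, then $\operatorname{Flip}(U)=U''$. Else $\operatorname{Flip}(U)=(-u^1,2u^1+u^2)$. * Case 3: $\mathcal{U}\cap\operatorname{GP}(\mathcal{U})=\{z,z+u^1\}$ and $H^i\cap\mathbb{Z}^2=\{z+ku^1+iu^2\}$ for some $i\in\{-1,1\}$ and some $k$. Then $\operatorname{Flip}(U)=(ku^1+iu^2,\,-(k-1)u^1-iu^2)$.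 * Case 4: $\mathcal{U}\cap\operatorname{GP}(\mathcal{U})=\{z,z+u^1\}$ and $|H^i\cap\mathbb{Z}^2|\ge 2$ for some $i\in\{-1,1\}$. Let $z+ku^1+iu^2\in H^i\cap\mathbb{Z}^2$ with $|k|$ minimal. Then $\operatorname{Flip}(U)=(u^1,ku^1+iu^2)$ if $k\ge 0$, and $\operatorname{Flip}(U)=(u^1,(k-1)u^1+iu^2)$ if $k\le -1$. * Case 5: $\mathcal{U}\cap\operatorname{GP}(\mathcal{U})=\{z,z+u^1,z+u^2\}$ and $|H^i\cap\mathbb{Z}^2|\ge 1$ for some $i\in\{-1,1\}$. Then $\operatorname{Flip}(U)=(u^1,-u^1+u^2)$ if $i=1$, and $\operatorname{Flip}(U)=(u^1-u^2,u^2)$ if $i=-1$. **Sequence.** A sequence $(\mathcal{U}^i)_{i\ge 0}$ of subsets of $\mathbb{Z}^2$ is *constructed using the table* if $\mathcal{U}^0$ is unimodular and, for every $i\ge 0$: if $\nabla f(w)=\mathbf{0}$ for some $w\in\mathcal{U}^i$, then $\mathcal{U}^{i+1}=\mathcal{U}^i$; otherwise, for some preprocessed labelling $(z,U)$ of $\mathcal{U}^i$,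 either a case of the table applies and $\mathcal{U}^{i+1}=\mathcal{U}(z,\operatorname{Flip}(U))$, or no case applies and $\mathcal{U}^{i+1}=\mathcal{U}^i$. (Any choice left open by this description may be made arbitrarily at each step.) **Theorem.** For every unimodular set $\mathcal{U}^0$ and every sequence $(\mathcal{U}^i)_{i\ge 0}$ starting at $\mathcal{U}^0$ that is constructed using the table, there is an index $T_1$ such that for all $i\ge T_1$ the set $\mathcal{U}^i$ contains an optimal solution of $\min\{f(z): z\in\mathbb{Z}^2\}$. -/

import Mathlib

namespace GradFlip

/-- The lattice `ℤ²`. -/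
abbrev Lattice : Type := Fin 2 → ℤ

/-- The Euclidean plane `ℝ²`. -/
abbrev Plane : Type := EuclideanSpace ℝ (Fin 2)

/-- The inclusion `ℤ² ⊆ ℝ²`. -/
def emb (w : Lattice) : Plane := WithLp.toLp 2 (fun j => (w j : ℝ))

/-- `w` is an optimal solution of `min {f z : z ∈ ℤ²}`. -/
def IsOptimal (f : Plane → ℝ) (w : Lattice) : Prop :=
  ∀ v : Lattice, f (emb w) ≤ f (emb v)

/-- `a` strictly cuts `b`: `∇f(a)ᵀ(b - a) > 0`. -/
def StrictlyCuts (f : Plane → ℝ) (a b : Lattice) : Prop :=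
  0 < inner ℝ (gradient f (emb a)) (emb b - emb a)

/-- The gradient polyhedron `GP(X)` of a set `X` of lattice vectors. -/
def GP (f : Plane → ℝ) (X : Set Lattice) : Set Plane :=
  {y | ∀ w ∈ X, inner ℝ (gradient f (emb w)) (y - emb w) ≤ 0}

/-- `intr(GP(X))`: all the inequalities defining `GP(X)` are strict. -/
def intrGP (f : Plane → ℝ) (X : Set Lattice) : Set Plane :=
  {y | ∀ w ∈ X, inner ℝ (gradient f (emb w)) (y - emb w) < 0}

/-- `X ∩ GP(X)`, as a set of lattice vectors. -/
def core (f : Plane → ℝ) (X : Set Lattice) : Set Lattice :=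
  {w | w ∈ X ∧ emb w ∈ GP f X}

/-- The set `𝒰(z, U) = {z + U e : e ∈ {0,1}²}`. -/
def uset (z : Lattice) (U : Matrix (Fin 2) (Fin 2) ℤ) : Set Lattice :=
  {w | ∃ e : Lattice, (∀ j, e j = 0 ∨ e j = 1) ∧ w = z + U.mulVec e}

/-- `(z, U)` is a labelling of the set `A` as a unimodular set. -/
def IsLabelling (A : Set Lattice) (z : Lattice) (U : Matrix (Fin 2) (Fin 2) ℤ) : Prop :=
  |U.det| = 1 ∧ A = uset z U

/-- `A ⊆ ℤ²` is unimodular. -/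
def IsUnimodularSet (A : Set Lattice) : Prop :=
  ∃ z U, IsLabelling A z U

/-- The matrix with columns `a` and `b`. -/
def cols (a b : Lattice) : Matrix (Fin 2) (Fin 2) ℤ :=
  Matrix.of fun r c => if c = 0 then a r else b r

/-- The preprocessing properties of a labelling `(z, U)`. -/
def Preprocessed (f : Plane → ℝ) (z : Lattice) (U : Matrix (Fin 2) (Fin 2) ℤ) : Prop :=
  emb z ∈ GP f (uset z U) ∧
  ((core f (uset z U)).encard = 2 →
    core f (uset z U) = {z, z + U.col 0} ∨
    (core f (uset z U) = {z, z + U.col 0 + U.col 1} ∧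
      StrictlyCuts f z (z + U.col 0) ∧
      StrictlyCuts f (z + U.col 0 + U.col 1) (z + U.col 1))) ∧
  ((core f (uset z U)).encard = 3 →
    core f (uset z U) = {z, z + U.col 0, z + U.col 1})

/-- `A` is connected: after preprocessing, `A ∩ GP(A)` contains the vectors `z` and `z + u¹`. -/
def IsConnectedSet (f : Plane → ℝ) (A : Set Lattice) : Prop :=
  ∃ z U, IsLabelling A z U ∧ Preprocessed f z U ∧ {z, z + U.col 0} ⊆ core f A

/-- The segment `Hⁱ = {z + k u¹ + i u² ∈ intr(GP(𝒰(z, U))) : k ∈ ℝ}`. -/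
def H (f : Plane → ℝ) (z : Lattice) (U : Matrix (Fin 2) (Fin 2) ℤ) (i : ℤ) : Set Plane :=
  {y | (∃ k : ℝ, y = emb z + k • emb (U.col 0) + (i : ℝ) • emb (U.col 1)) ∧
    y ∈ intrGP f (uset z U)}

/-- `Hⁱ ∩ ℤ²`, as a set of lattice vectors. -/
def HZ (f : Plane → ℝ) (z : Lattice) (U : Matrix (Fin 2) (Fin 2) ℤ) (i : ℤ) : Set Lattice :=
  {w | emb w ∈ H f z U i}

/-- The sign used in the first case: `1` if `∇f(z)ᵀ u ≤ 0` and `-1` otherwise. -/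
noncomputable def sigma (f : Plane → ℝ) (z u : Lattice) : ℤ :=
  if inner ℝ (gradient f (emb z)) (emb u) ≤ 0 then 1 else -1

/-- Case 1 of the table, with outcome `V`. -/
def Flip1 (f : Plane → ℝ) (z : Lattice) (U V : Matrix (Fin 2) (Fin 2) ℤ) : Prop :=
  core f (uset z U) = {z} ∧
  V = cols (sigma f z (U.col 0) • U.col 0) (sigma f z (U.col 1) • U.col 1)

/-- The condition in case 2 for the outcome `U' = (u¹, u¹ + u²)`. -/
def Cond2' (f : Plane → ℝ) (z : Lattice) (U : Matrix (Fin 2) (Fin 2) ℤ) : Prop :=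
  IsConnectedSet f (uset z (cols (U.col 0) (U.col 0 + U.col 1))) ∨
  core f (uset z (cols (U.col 0) (U.col 0 + U.col 1))) =
    {z + (2 : ℤ) • U.col 0 + U.col 1} ∨
  (StrictlyCuts f (z + U.col 0 + U.col 1) (z - U.col 0) ∧ StrictlyCuts f (z - U.col 0) z)

/-- The condition in case 2 for the outcome `U'' = (-u¹, u¹ + u²)`. -/
def Cond2'' (f : Plane → ℝ) (z : Lattice) (U : Matrix (Fin 2) (Fin 2) ℤ) : Prop :=
  IsConnectedSet f (uset z (cols (-U.col 0) (U.col 0 + U.col 1))) ∨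
  core f (uset z (cols (-U.col 0) (U.col 0 + U.col 1))) = {z - U.col 0} ∨
  (StrictlyCuts f z (z + (2 : ℤ) • U.col 0 + U.col 1) ∧
    StrictlyCuts f (z + (2 : ℤ) • U.col 0 + U.col 1) (z + U.col 0 + U.col 1))

/-- Case 2 of the table, with outcome `V`. -/
def Flip2 (f : Plane → ℝ) (z : Lattice) (U V : Matrix (Fin 2) (Fin 2) ℤ) : Prop :=
  core f (uset z U) = {z, z + U.col 0 + U.col 1} ∧
  ((Cond2' f z U ∧ V = cols (U.col 0) (U.col 0 + U.col 1)) ∨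
   (¬ Cond2' f z U ∧ Cond2'' f z U ∧ V = cols (-U.col 0) (U.col 0 + U.col 1)) ∨
   (¬ Cond2' f z U ∧ ¬ Cond2'' f z U ∧
      V = cols (-U.col 0) ((2 : ℤ) • U.col 0 + U.col 1)))

/-- Case 3 of the table, with outcome `V`. -/
def Flip3 (f : Plane → ℝ) (z : Lattice) (U V : Matrix (Fin 2) (Fin 2) ℤ) : Prop :=
  core f (uset z U) = {z, z + U.col 0} ∧
  ∃ i : ℤ, (i = -1 ∨ i = 1) ∧ (HZ f z U i).encard = 1 ∧
    ∃ k : ℤ, z + k • U.col 0 + i • U.col 1 ∈ HZ f z U i ∧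
      V = cols (k • U.col 0 + i • U.col 1) (-((k - 1) • U.col 0) - i • U.col 1)

/-- Case 4 of the table, with outcome `V`. -/
def Flip4 (f : Plane → ℝ) (z : Lattice) (U V : Matrix (Fin 2) (Fin 2) ℤ) : Prop :=
  core f (uset z U) = {z, z + U.col 0} ∧
  ∃ i : ℤ, (i = -1 ∨ i = 1) ∧ 2 ≤ (HZ f z U i).encard ∧
    ∃ k : ℤ, z + k • U.col 0 + i • U.col 1 ∈ HZ f z U i ∧
      (∀ l : ℤ, z + l • U.col 0 + i • U.col 1 ∈ HZ f z U i → |k| ≤ |l|) ∧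
      ((0 ≤ k ∧ V = cols (U.col 0) (k • U.col 0 + i • U.col 1)) ∨
       (k ≤ -1 ∧ V = cols (U.col 0) ((k - 1) • U.col 0 + i • U.col 1)))

/-- Case 5 of the table, with outcome `V`. -/
def Flip5 (f : Plane → ℝ) (z : Lattice) (U V : Matrix (Fin 2) (Fin 2) ℤ) : Prop :=
  core f (uset z U) = {z, z + U.col 0, z + U.col 1} ∧
  ∃ i : ℤ, (i = -1 ∨ i = 1) ∧ 1 ≤ (HZ f z U i).encard ∧
    ((i = 1 ∧ V = cols (U.col 0) (-U.col 0 + U.col 1)) ∨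
     (i = -1 ∧ V = cols (U.col 0 - U.col 1) (U.col 1)))

/-- `V` is a possible value of `Flip(U)` in the table, for the labelling `(z, U)`. -/
def IsFlip (f : Plane → ℝ) (z : Lattice) (U V : Matrix (Fin 2) (Fin 2) ℤ) : Prop :=
  Flip1 f z U V ∨ Flip2 f z U V ∨ Flip3 f z U V ∨ Flip4 f z U V ∨ Flip5 f z U V

/-- `B` is a possible successor of `A`. If `A` contains a vector with zero gradient, then `A` is
not changed. Otherwise `A` is labelled so that the preprocessing properties hold and it is flipped
by the table; if no case of the table applies, then `A` is not changed. -/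
def IsUpdate (f : Plane → ℝ) (A B : Set Lattice) : Prop :=
  ((∃ w ∈ A, gradient f (emb w) = 0) ∧ B = A) ∨
  ((∀ w ∈ A, gradient f (emb w) ≠ 0) ∧
    ∃ z U, IsLabelling A z U ∧ Preprocessed f z U ∧
      ((∃ V, IsFlip f z U V ∧ B = uset z V) ∨ ((∀ V, ¬ IsFlip f z U V) ∧ B = A)))

end GradFlip

namespace GradFlip

/-! Call the vectors of a unimodular set that no vector of the set strictly cuts its core. By the
first-order inequality of convex functions a strict cut of `b` by `a` gives `f a < f b`. So an
optimal vector is never cut, and since every case of the table keeps the core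
(`core_subset_of_isFlip`), it is never lost again. It remains to reach one.

Suppose that no set of the sequence contains an optimal vector. Then each set is strictly beaten by
some lattice vector `x`, and some case of the table applies (`exists_isFlip`). The least value on
the set need not drop at each step. Progress is measured by `Prec` instead: the new core has a new
vector whose value is below the values of all vectors that were dropped. Infinitely many such
improvements are impossible for cores of bounded size when sublevel sets contain finitely many
lattice vectors (`not_forall_prec`): beyond some index the good vectors are kept forever, so the
number of them would grow without bound.

Most flips improve the core at once, typically because no core vector cuts a vector brought in
(`prec_of_not_cut`). Two outcomes need a second step (`exists_prec`). In case 2 the core may stay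
the same, but the former diagonal has become an edge, so case 2 does not apply again. In case 3 the
edge `z, z + u` becomes a diagonal, with `p = z + k u + i v` and its reflection `p' = 2z + u - p` as
the other two corners. If `p'` spoils the improvement, the core collapses to one end of the edge,
every better vector is that end plus a multiple of `±(p - p')`, and the next flip (case 1) brings in
the first such multiple, which is better than both ends.

The verifications are linear inequalities between the values `φ` and the derivatives `P`, `Q` of `f`
in lattice coordinates; the better vector `x` excludes the bad configurations. -/

theorem emb_add (a b : Lattice) : emb (a + b) = emb a + emb b := by
  ext j; simp [emb]

theorem emb_zsmul (n : ℤ) (a : Lattice) : emb (n • a) = (n : ℝ) • emb a := by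
  ext j; simp [emb]

/-- The first-order inequality of a differentiable convex function. -/
theorem inner_gradient_le {f : Plane → ℝ} (hconv : ConvexOn ℝ Set.univ f)
    (hdiff : Differentiable ℝ f) (x y : Plane) :
    f x + inner ℝ (gradient f x) (y - x) ≤ f y := by
  have hline : HasDerivAt (fun t : ℝ => f (x + t • (y - x)))
      (inner ℝ (gradient f x) (y - x)) 0 := by
    have h1 : HasFDerivAt f (InnerProductSpace.toDual ℝ Plane (gradient f x)) (x + (0 : ℝ) • (y - x)) := by
      simpa using (hdiff x).hasGradientAt.hasFDerivAt
    have h2 : HasDerivAt (fun t : ℝ => x + t • (y - x)) (y - x) 0 := by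
      simpa using ((hasDerivAt_id (0 : ℝ)).smul_const (y - x)).const_add x
    have h3 := h1.comp_hasDerivAt (0 : ℝ) h2
    rw [InnerProductSpace.toDual_apply_apply] at h3
    exact h3
  have hcv : ConvexOn ℝ Set.univ (fun t : ℝ => f (x + t • (y - x))) := by
    have := hconv.comp_affineMap (AffineMap.lineMap x y)
    simpa [Function.comp_def, AffineMap.lineMap_apply, add_comm] using this
  have := hcv.le_slope_of_hasDerivAt (Set.mem_univ 0) (Set.mem_univ 1) zero_lt_one hline
  simp only [slope_def_field, one_smul, zero_smul, add_zero, sub_zero, div_one,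
    add_sub_cancel] at this
  linarith

/-! ### Lattice coordinates relative to a unimodular pair -/

/-- The lattice vector with coordinates `(a, b)` relative to the origin `z` and the columns
`u`, `v`. -/
def pt (z u v : Lattice) (a b : ℤ) : Lattice := z + a • u + b • v

/-- The determinant of the pair `(u, v)`. -/
def det2 (u v : Lattice) : ℤ := u 0 * v 1 - v 0 * u 1

/-- The four vectors of the parallelogram spanned by `u`, `v` at `z`. -/
def box (z u v : Lattice) : Set Lattice := {z, z + u, z + v, z + u + v}

theorem det_eq_det2 (U : Matrix (Fin 2) (Fin 2) ℤ) : U.det = det2 (U.col 0) (U.col 1) := by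
  simp [Matrix.det_fin_two, det2, Matrix.col]

theorem mulVec_eq (U : Matrix (Fin 2) (Fin 2) ℤ) (e : Lattice) :
    U.mulVec e = e 0 • U.col 0 + e 1 • U.col 1 := by
  funext r
  simp [Matrix.mulVec, dotProduct, Fin.sum_univ_two, Matrix.col, mul_comm]

theorem uset_eq_box (z : Lattice) (U : Matrix (Fin 2) (Fin 2) ℤ) :
    uset z U = box z (U.col 0) (U.col 1) := by
  ext w
  simp only [uset, box, Set.mem_ofPred_eq, Set.mem_insert_iff, Set.mem_singleton_iff, mulVec_eq]
  constructor
  · rintro ⟨e, he, rfl⟩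
    rcases he 0 with h0 | h0 <;> rcases he 1 with h1 | h1 <;> simp [h0, h1, add_assoc]
  · rintro (h | h | h | h)
    · exact ⟨![0, 0], by intro j; fin_cases j <;> simp, by simp [h]⟩
    · exact ⟨![1, 0], by intro j; fin_cases j <;> simp, by simp [h]⟩
    · exact ⟨![0, 1], by intro j; fin_cases j <;> simp, by simp [h]⟩
    · exact ⟨![1, 1], by intro j; fin_cases j <;> simp, by simp [h, add_assoc]⟩

@[simp] theorem cols_col_zero (a b : Lattice) : (cols a b).col 0 = a := by
  funext r; simp [cols, Matrix.col]

@[simp] theorem cols_col_one (a b : Lattice) : (cols a b).col 1 = b := by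
  funext r; simp [cols, Matrix.col]

theorem uset_cols (z a b : Lattice) : uset z (cols a b) = box z a b := by
  simp [uset_eq_box]

theorem isLabelling_cols {z a b : Lattice} (h : |det2 a b| = 1) :
    IsLabelling (box z a b) z (cols a b) := by
  refine ⟨by simpa [det_eq_det2] using h, (uset_cols z a b).symm⟩

theorem pt_eq_iff {z u v : Lattice} (h : |det2 u v| = 1) {a b c d : ℤ} :
    pt z u v a b = pt z u v c d ↔ a = c ∧ b = d := by
  constructor
  · intro e
    have h0 := congrFun e 0
    have h1 := congrFun e 1
    simp only [pt, Pi.add_apply, Pi.smul_apply, smul_eq_mul] at h0 h1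
    have hD : det2 u v ≠ 0 := by intro h'; simp [h'] at h
    have ha : det2 u v * (a - c) = 0 := by
      unfold det2; linear_combination v 1 * h0 - v 0 * h1
    have hb : det2 u v * (b - d) = 0 := by
      unfold det2; linear_combination u 0 * h1 - u 1 * h0
    have ha := (mul_eq_zero.1 ha).resolve_left hD
    have hb := (mul_eq_zero.1 hb).resolve_left hD
    omega
  · rintro ⟨rfl, rfl⟩; rfl

theorem exists_pt {z u v : Lattice} (h : |det2 u v| = 1) (w : Lattice) :
    ∃ a b : ℤ, w = pt z u v a b := by
  have hD : det2 u v * det2 u v = 1 := by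
    rw [← abs_mul_abs_self, h]; norm_num
  refine ⟨det2 u v * ((w 0 - z 0) * v 1 - (w 1 - z 1) * v 0),
    det2 u v * ((w 1 - z 1) * u 0 - (w 0 - z 0) * u 1), ?_⟩
  funext j
  simp only [pt, Pi.add_apply, Pi.smul_apply, smul_eq_mul]
  fin_cases j
  · simp only [Fin.zero_eta]
    have : w 0 - z 0 = det2 u v * det2 u v * (w 0 - z 0) := by rw [hD, one_mul]
    have e : det2 u v * det2 u v * (w 0 - z 0) =
      det2 u v * ((u 0 * v 1 - v 0 * u 1) * (w 0 - z 0)) := by simp only [det2]; ring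
    linear_combination this + e
  · simp only [Fin.mk_one]
    have : w 1 - z 1 = det2 u v * det2 u v * (w 1 - z 1) := by rw [hD, one_mul]
    have e : det2 u v * det2 u v * (w 1 - z 1) =
      det2 u v * ((u 0 * v 1 - v 0 * u 1) * (w 1 - z 1)) := by simp only [det2]; ring
    linear_combination this + e

theorem emb_pt (z u v : Lattice) (a b : ℤ) :
    emb (pt z u v a b) = emb z + (a : ℝ) • emb u + (b : ℝ) • emb v := by
  simp only [pt, emb_add, emb_zsmul]

/-- The points of the parallelogram in coordinates. -/
theorem box_eq_pt (z u v : Lattice) :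
    box z u v = {pt z u v 0 0, pt z u v 1 0, pt z u v 0 1, pt z u v 1 1} := by
  simp [box, pt]

/-- The values and directional derivatives of `f` along the lattice, in coordinates. -/
theorem exists_coords {f : Plane → ℝ} (hconv : ConvexOn ℝ Set.univ f)
    (hdiff : Differentiable ℝ f) (z u v : Lattice) :
    ∃ φ P Q : ℤ → ℤ → ℝ,
      (∀ a b c d : ℤ, φ a b + ((c - a : ℝ) * P a b + (d - b : ℝ) * Q a b) ≤ φ c d) ∧
      (∀ a b, f (emb (pt z u v a b)) = φ a b) ∧
      (∀ a b c d : ℤ, inner ℝ (gradient f (emb (pt z u v a b)))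
        (emb (pt z u v c d) - emb (pt z u v a b)) = (c - a : ℝ) * P a b + (d - b : ℝ) * Q a b) := by
  have key : ∀ a b c d : ℤ, inner ℝ (gradient f (emb (pt z u v a b)))
        (emb (pt z u v c d) - emb (pt z u v a b)) =
        (c - a : ℝ) * inner ℝ (gradient f (emb (pt z u v a b))) (emb u) +
        (d - b : ℝ) * inner ℝ (gradient f (emb (pt z u v a b))) (emb v) := by
    intro a b c d
    have : emb (pt z u v c d) - emb (pt z u v a b) =
        (c - a : ℝ) • emb u + (d - b : ℝ) • emb v := by
      simp only [emb_pt]; module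
    rw [this, inner_add_right, inner_smul_right, inner_smul_right]
  refine ⟨fun a b => f (emb (pt z u v a b)),
    fun a b => inner ℝ (gradient f (emb (pt z u v a b))) (emb u),
    fun a b => inner ℝ (gradient f (emb (pt z u v a b))) (emb v), ?_, fun _ _ => rfl, key⟩
  intro a b c d
  have := inner_gradient_le hconv hdiff (emb (pt z u v a b)) (emb (pt z u v c d))
  rw [key] at this
  exact this

/-! ### Cores -/

theorem mem_core_iff {f : Plane → ℝ} {X : Set Lattice} {w : Lattice} :
    w ∈ core f X ↔ w ∈ X ∧ ∀ a ∈ X, ¬ StrictlyCuts f a w := by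
  simp [core, GP, StrictlyCuts]

theorem StrictlyCuts.lt {f : Plane → ℝ} (hconv : ConvexOn ℝ Set.univ f)
    (hdiff : Differentiable ℝ f) {a b : Lattice} (h : StrictlyCuts f a b) :
    f (emb a) < f (emb b) := by
  have := inner_gradient_le hconv hdiff (emb a) (emb b)
  unfold StrictlyCuts at h
  linarith

theorem not_strictlyCuts_self (f : Plane → ℝ) (a : Lattice) : ¬ StrictlyCuts f a a := by
  simp [StrictlyCuts]

/-- `C'` precedes `C`: it has a new vector whose value is below those of all dropped vectors. -/
def Prec (f : Plane → ℝ) (C' C : Set Lattice) : Prop :=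
  ∃ r ∈ C', r ∉ C ∧ ∀ d ∈ C, d ∉ C' → f (emb r) < f (emb d)

theorem exists_minimizer (f : Plane → ℝ) {X : Set Lattice} (hX : X.Finite) (hne : X.Nonempty) :
    ∃ r ∈ X, ∀ w ∈ X, f (emb r) ≤ f (emb w) :=
  Set.exists_min_image X (fun w => f (emb w)) hX hne

theorem box_finite (z u v : Lattice) : (box z u v).Finite := by
  simp [box]

/-- If no vector of the core cuts a new vector, then the core improves. -/
theorem prec_of_not_cut {f : Plane → ℝ} (hconv : ConvexOn ℝ Set.univ f)
    (hdiff : Differentiable ℝ f) {A B : Set Lattice} (hB : B.Finite) (hsub : core f A ⊆ B)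
    (hne : ∃ w ∈ B, w ∉ core f A)
    (hcut : ∀ c ∈ core f A, ∀ w ∈ B, w ∉ core f A → ¬ StrictlyCuts f c w) :
    Prec f (core f B) (core f A) := by
  -- The best vector brought in: core vectors do not cut it, and the other vectors have no smaller
  -- value. A dropped core vector can only be cut by a vector brought in, hence has a value above
  -- that of `r`.
  obtain ⟨r, ⟨hrB, hrA⟩, hr⟩ := exists_minimizer f (X := B \ core f A) (hB.subset Set.sdiff_subset)
    (by obtain ⟨w, h1, h2⟩ := hne; exact ⟨w, h1, h2⟩)
  refine ⟨r, mem_core_iff.2 ⟨hrB, fun a ha hc => ?_⟩, hrA, fun d hd hdB => ?_⟩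
  · by_cases haA : a ∈ core f A
    · exact hcut a haA r hrB hrA hc
    · exact absurd (hc.lt hconv hdiff) (not_lt.2 (hr a ⟨ha, haA⟩))
  · have : ∃ a ∈ B, StrictlyCuts f a d := by
      by_contra! h
      exact hdB (mem_core_iff.2 ⟨hsub hd, h⟩)
    obtain ⟨a, ha, hc⟩ := this
    have haA : a ∉ core f A := fun h => (mem_core_iff.1 hd).2 a (mem_core_iff.1 h).1 hc
    exact lt_of_le_of_lt (hr a ⟨ha, haA⟩) (hc.lt hconv hdiff)

/-- A new minimum gives an improvement. -/
theorem prec_of_lt {f : Plane → ℝ} (hconv : ConvexOn ℝ Set.univ f)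
    (hdiff : Differentiable ℝ f) {C B : Set Lattice} (hB : B.Finite)
    {w : Lattice} (hw : w ∈ B) (hlt : ∀ c ∈ C, f (emb w) < f (emb c)) :
    Prec f (core f B) C := by
  obtain ⟨r, hrB, hr⟩ := exists_minimizer f hB ⟨w, hw⟩
  have h : ∀ c ∈ C, f (emb r) < f (emb c) := fun c hc => lt_of_le_of_lt (hr w hw) (hlt c hc)
  exact ⟨r, mem_core_iff.2 ⟨hrB, fun a ha hc => absurd (hc.lt hconv hdiff) (not_lt.2 (hr a ha))⟩,
    fun hrC => lt_irrefl _ (h r hrC), fun d hd _ => h d hd⟩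

/-- If the new vector `r` lies in the new core and every cut of a vector of the old core by the new
set comes from a vector with value at least that of `r`, then the core improves. -/
theorem prec_of_mem {f : Plane → ℝ} {A B : Set Lattice} (hsub : core f A ⊆ B) {r : Lattice}
    (hr : r ∈ core f B) (hrA : r ∉ core f A)
    (hlt : ∀ d ∈ core f A, ∀ a ∈ B, StrictlyCuts f a d → f (emb r) < f (emb d)) :
    Prec f (core f B) (core f A) := by
  refine ⟨r, hr, hrA, fun d hd hdB => ?_⟩
  have : ∃ a ∈ B, StrictlyCuts f a d := by
    by_contra! h
    exact hdB (mem_core_iff.2 ⟨hsub hd, h⟩)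
  obtain ⟨a, ha, hc⟩ := this
  exact hlt d hd a ha hc

/-! ### Cuts and gradient polyhedra in coordinates -/

/-- The values `φ` and the derivatives `P`, `Q` along `u`, `v` of `f`, in lattice coordinates. -/
structure Coords (f : Plane → ℝ) (z u v : Lattice) (φ P Q : ℤ → ℤ → ℝ) : Prop where
  sub : ∀ a b c d : ℤ, φ a b + ((c - a : ℝ) * P a b + (d - b : ℝ) * Q a b) ≤ φ c d
  val : ∀ a b, f (emb (pt z u v a b)) = φ a b
  inn : ∀ a b c d : ℤ, inner ℝ (gradient f (emb (pt z u v a b)))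
    (emb (pt z u v c d) - emb (pt z u v a b)) = (c - a : ℝ) * P a b + (d - b : ℝ) * Q a b

theorem Coords.cut {f : Plane → ℝ} {z u v : Lattice} {φ P Q : ℤ → ℤ → ℝ}
    (h : Coords f z u v φ P Q) (a b c d : ℤ) :
    StrictlyCuts f (pt z u v a b) (pt z u v c d) ↔
      0 < (c - a : ℝ) * P a b + (d - b : ℝ) * Q a b := by
  rw [StrictlyCuts, h.inn]

theorem pt_zero_zero (z u v : Lattice) : pt z u v 0 0 = z := by simp [pt]

theorem pt_one_zero (z u v : Lattice) : pt z u v 1 0 = z + u := by simp [pt]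

theorem pt_zero_one (z u v : Lattice) : pt z u v 0 1 = z + v := by simp [pt]

theorem pt_one_one (z u v : Lattice) : pt z u v 1 1 = z + u + v := by simp [pt]

theorem forall_mem_box {z u v : Lattice} {p : Lattice → Prop} :
    (∀ w ∈ box z u v, p w) ↔
      p (pt z u v 0 0) ∧ p (pt z u v 1 0) ∧ p (pt z u v 0 1) ∧ p (pt z u v 1 1) := by
  simp [box_eq_pt]

theorem mem_HZ_iff {f : Plane → ℝ} {z : Lattice} {U : Matrix (Fin 2) (Fin 2) ℤ} {i : ℤ}
    (hU : |U.det| = 1) {w : Lattice} :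
    w ∈ HZ f z U i ↔ (∃ c : ℤ, w = pt z (U.col 0) (U.col 1) c i) ∧ emb w ∈ intrGP f (uset z U) := by
  rw [det_eq_det2] at hU
  simp only [HZ, H, Set.mem_ofPred_eq]
  refine and_congr_left fun _ => ⟨?_, ?_⟩
  · rintro ⟨k, hk⟩
    obtain ⟨a, b, rfl⟩ := exists_pt (z := z) hU w
    have hb : b = i := by
      rw [emb_pt] at hk
      have h0 := congrArg (fun y : Plane => y 0) hk
      have h1 := congrArg (fun y : Plane => y 1) hk
      simp [emb] at h0 h1
      have hD : det2 (U.col 0) (U.col 1) ≠ 0 := by intro h'; simp [h'] at hU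
      have hD' : (U 0 0 * U 1 1 - U 0 1 * U 1 0 : ℝ) ≠ 0 := by
        simp only [det2, Matrix.col_apply] at hD
        exact_mod_cast hD
      have : (U 0 0 * U 1 1 - U 0 1 * U 1 0 : ℝ) * (b - i) = 0 := by
        linear_combination (U 0 0 : ℝ) * h1 - (U 1 0 : ℝ) * h0
      have := (mul_eq_zero.1 this).resolve_left hD'
      have : (b : ℝ) = i := by linarith
      exact_mod_cast this
    exact ⟨a, by rw [hb]⟩
  · rintro ⟨c, rfl⟩
    exact ⟨c, emb_pt ..⟩

theorem Coords.intr_iff {f : Plane → ℝ} {z u v : Lattice} {φ P Q : ℤ → ℤ → ℝ}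
    (h : Coords f z u v φ P Q) (c d : ℤ) :
    emb (pt z u v c d) ∈ intrGP f (box z u v) ↔
      c * P 0 0 + d * Q 0 0 < 0 ∧ (c - 1) * P 1 0 + d * Q 1 0 < 0 ∧
      c * P 0 1 + (d - 1) * Q 0 1 < 0 ∧ (c - 1) * P 1 1 + (d - 1) * Q 1 1 < 0 := by
  change (∀ w ∈ box z u v, _) ↔ _
  rw [forall_mem_box]
  simp only [h.inn]
  simp

/-! ### Lattice vectors in the rows next to an edge -/

/-- The triangle spanned by `(0, 0)`, `(1, 0)` and `(x, y)` meets the lattice in the row `±1`. -/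
theorem exists_row_point (x y : ℤ) (hy : y ≠ 0) :
    ∃ c i n m : ℤ, (i = -1 ∨ i = 1) ∧ 0 < n ∧ 0 ≤ m ∧ m < n ∧ n * c = x + m ∧ n * i = y := by
  have hn : 0 < |y| := abs_pos.2 hy
  -- The column is `⌈x / |y|⌉`, written through the floor of `-x / |y|`, so that the remainder `m`
  -- lies in `[0, |y|)`.
  refine ⟨-((-x) / |y|), y.sign, |y|, (-x) % |y|, ?_, hn, Int.emod_nonneg _ hn.ne',
    Int.emod_lt_of_pos _ hn, ?_, ?_⟩
  · rcases lt_or_gt_of_ne hy with h | h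
    · left; exact Int.sign_eq_neg_one_of_neg h
    · right; exact Int.sign_eq_one_of_pos h
  · have := Int.mul_ediv_add_emod (-x) |y|
    linarith
  · rw [mul_comm]; exact Int.sign_mul_abs y

/-- If the core contains an edge and there is a better vector, then a neighbouring row meets the
interior of the gradient polyhedron. -/
theorem exists_mem_intrGP {f : Plane → ℝ} (hconv : ConvexOn ℝ Set.univ f)
    (hdiff : Differentiable ℝ f) {z u v : Lattice} (hU : |det2 u v| = 1)
    (h0 : z ∈ core f (box z u v)) (h1 : z + u ∈ core f (box z u v)) {x : Lattice}
    (hx : ∀ w ∈ box z u v, f (emb x) < f (emb w)) :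
    ∃ a b c i n m : ℤ, x = pt z u v a b ∧ (i = -1 ∨ i = 1) ∧ 0 < n ∧ 0 ≤ m ∧ m < n ∧
      n * c = a + m ∧ n * i = b ∧ emb (pt z u v c i) ∈ intrGP f (box z u v) := by
  obtain ⟨φ, P, Q, hs, hv, hi⟩ := exists_coords hconv hdiff z u v
  have H : Coords f z u v φ P Q := ⟨hs, hv, hi⟩
  obtain ⟨a, b, rfl⟩ := exists_pt (z := z) hU x
  replace h0 : pt z u v 0 0 ∈ core f (box z u v) := by
    rwa [pt_zero_zero]
  rw [← pt_one_zero z u v] at h1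
  simp only [mem_core_iff, forall_mem_box, H.cut] at h0 h1
  simp only [forall_mem_box, H.val] at hx
  simp only [not_lt] at h0 h1
  norm_num at h0 h1
  obtain ⟨-, p1, p2, p3⟩ := h0
  obtain ⟨-, q1, q2, q3⟩ := h1
  obtain ⟨x1, x2, x3, x4⟩ := hx
  have s1 := hs 0 0 a b
  have s2 := hs 1 0 a b
  have s3 := hs 0 1 a b
  have s4 := hs 1 1 a b
  norm_num at s1 s2 s3 s4
  -- The ends of the edge do not cut each other, so `f` does not fall when leaving the edge along
  -- its line.
  have hb : b ≠ 0 := by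
    rintro rfl
    norm_num at s1 s2
    rcases le_or_gt a 0 with h | h
    · have : (a : ℝ) ≤ 0 := by exact_mod_cast h
      nlinarith
    · have : (1 : ℝ) ≤ a := by exact_mod_cast h
      nlinarith
  obtain ⟨c, i, n, m, hi1, hn, hm, hmn, e1, e2⟩ := exists_row_point a b hb
  refine ⟨a, b, c, i, n, m, rfl, hi1, hn, hm, hmn, e1, e2, (H.intr_iff c i).2 ?_⟩
  have hn' : (0 : ℝ) < n := by exact_mod_cast hn
  have hm' : (0 : ℝ) ≤ m := by exact_mod_cast hm
  have hmn' : (0 : ℝ) ≤ n - 1 - m := by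
    have : (m : ℝ) + 1 ≤ n := by exact_mod_cast hmn
    linarith
  have e1' : (n : ℝ) * c = a + m := by exact_mod_cast e1
  have e2' : (n : ℝ) * i = b := by exact_mod_cast e2
  -- `(c, i)` is the convex combination of `(a, b)`, `(1, 0)` and `(0, 0)` with weights `1/n`, `m/n`
  -- and `(n - 1 - m)/n`. An inequality that is strict at the first vector and weak at the other two
  -- is strict at `(c, i)`.
  have key : ∀ p q s t : ℝ, (a - s) * p + (b - t) * q < 0 → (1 - s) * p + (0 - t) * q ≤ 0 →
      (0 - s) * p + (0 - t) * q ≤ 0 → (c - s) * p + (i - t) * q < 0 := by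
    intro p q s t h1 h2 h3
    have : n * ((c - s) * p + (i - t) * q) < 0 := by
      have : n * ((c - s) * p + (i - t) * q) = ((a - s) * p + (b - t) * q) +
          m * ((1 - s) * p + (0 - t) * q) + (n - 1 - m) * ((0 - s) * p + (0 - t) * q) := by
        linear_combination p * e1' + q * e2'
      rw [this]
      have := mul_nonneg hm' (neg_nonneg.2 h2)
      have := mul_nonneg hmn' (neg_nonneg.2 h3)
      linarith
    by_contra h
    exact absurd this (not_lt.2 (mul_nonneg hn'.le (not_lt.1 h)))
  refine ⟨?_, ?_, ?_, ?_⟩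
  · have := key (P 0 0) (Q 0 0) 0 0 (by linarith) (by linarith) (by linarith); simpa using this
  · have := key (P 1 0) (Q 1 0) 1 0 (by linarith) (by linarith) (by linarith); simpa using this
  · have := key (P 0 1) (Q 0 1) 0 1 (by linarith) (by linarith) (by linarith); simpa using this
  · exact key (P 1 1) (Q 1 1) 1 1 (by linarith) (by linarith) (by linarith)

/-- If no vector of `A` cuts another one, then `A` contains an optimal vector. -/
theorem not_lt_of_core_eq {f : Plane → ℝ} (hconv : ConvexOn ℝ Set.univ f)
    (hdiff : Differentiable ℝ f) {z u v : Lattice} (hU : |det2 u v| = 1)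
    (hA : core f (box z u v) = box z u v) {x : Lattice}
    (hx : ∀ w ∈ box z u v, f (emb x) < f (emb w)) : False := by
  have hmem : ∀ w ∈ box z u v, w ∈ core f (box z u v) := by
    intro w hw; rwa [hA]
  obtain ⟨-, -, c, i, -, -, -, hi, -, -, -, -, -, hc⟩ := exists_mem_intrGP hconv hdiff hU
    (hmem _ (by simp [box])) (hmem _ (by simp [box])) hx
  obtain ⟨φ, P, Q, hs, hv, hin⟩ := exists_coords hconv hdiff z u v
  have H : Coords f z u v φ P Q := ⟨hs, hv, hin⟩
  rw [H.intr_iff] at hc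
  simp only [mem_core_iff, forall_mem_box, H.cut, not_lt] at hmem
  norm_num at hmem
  obtain ⟨⟨-, a1, a2, a3⟩, ⟨-, b1, b2, b3⟩, ⟨-, c1, c2, c3⟩, -, d1, d2, d3⟩ := hmem
  obtain ⟨h1, h2, h3, h4⟩ := hc
  -- A lattice vector of row `±1` lies in the outward quadrant of one of the four corners. There the
  -- derivatives at that corner are non-negative, against the strict inequality.
  have hcc : (c : ℝ) ≤ 0 ∨ (1 : ℝ) ≤ c := by
    rcases le_or_gt c 0 with h | h
    · left; exact_mod_cast h
    · right; exact_mod_cast h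
  rcases hi with rfl | rfl <;> norm_num at h1 h2 h3 h4 <;> rcases hcc with hc | hc <;> nlinarith

/-! ### Case 1: one core vector -/

theorem strictlyCuts_add_iff {f : Plane → ℝ} {z a : Lattice} :
    StrictlyCuts f z (z + a) ↔ 0 < inner ℝ (gradient f (emb z)) (emb a) := by
  rw [StrictlyCuts, emb_add, add_sub_cancel_left]

theorem pair_eq_pt (z u v : Lattice) :
    ({z, z + u} : Set Lattice) = {pt z u v 0 0, pt z u v 1 0} := by simp [pt]

theorem diag_eq_pt (z u v : Lattice) :
    ({z, z + u + v} : Set Lattice) = {pt z u v 0 0, pt z u v 1 1} := by simp [pt]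

theorem triple_eq_pt (z u v : Lattice) :
    ({z, z + u, z + v} : Set Lattice) = {pt z u v 0 0, pt z u v 1 0, pt z u v 0 1} := by simp [pt]

theorem ne_zero_of_det2 {u v : Lattice} (h : |det2 u v| = 1) : u ≠ 0 ∧ v ≠ 0 := by
  constructor <;> rintro rfl <;> simp [det2] at h

/-- The signs make both new edges non-ascending at `z`, so `z` cuts no vector of the new
parallelogram. -/
theorem prec_of_flip1 {f : Plane → ℝ} (hconv : ConvexOn ℝ Set.univ f)
    (hdiff : Differentiable ℝ f) {z : Lattice} {U V : Matrix (Fin 2) (Fin 2) ℤ}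
    (hU : |U.det| = 1) (hV : Flip1 f z U V) :
    Prec f (core f (uset z V)) (core f (uset z U)) := by
  obtain ⟨hcore, rfl⟩ := hV
  have hsig : ∀ u : Lattice, inner ℝ (gradient f (emb z)) (emb (sigma f z u • u)) ≤ 0 := by
    intro u
    rw [emb_zsmul, inner_smul_right, sigma]
    split_ifs with h
    · simpa using h
    · push Not at h; push_cast; linarith
  have hne : sigma f z (U.col 0) • U.col 0 ≠ 0 := by
    rw [det_eq_det2] at hU
    refine smul_ne_zero ?_ (ne_zero_of_det2 hU).1
    rw [sigma]; split_ifs <;> norm_num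
  rw [uset_cols]
  set a := sigma f z (U.col 0) • U.col 0
  set b := sigma f z (U.col 1) • U.col 1
  have ha : inner ℝ (gradient f (emb z)) (emb a) ≤ 0 := hsig _
  have hb : inner ℝ (gradient f (emb z)) (emb b) ≤ 0 := hsig _
  refine prec_of_not_cut hconv hdiff (box_finite ..) ?_ ⟨z + a, by simp [box], ?_⟩ ?_
  · rw [hcore]; simp [box]
  · rw [hcore]; simpa using hne
  · rw [hcore]
    rintro c rfl w hw -
    rcases hw with rfl | rfl | rfl | rfl
    · exact not_strictlyCuts_self _ _
    · rw [strictlyCuts_add_iff]; exact not_lt.2 ha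
    · rw [strictlyCuts_add_iff]; exact not_lt.2 hb
    · rw [add_assoc, strictlyCuts_add_iff, emb_add, inner_add_right]; linarith

/-- The coordinates of a core vector: no vector of the parallelogram cuts it. -/
theorem Coords.mem_core {f : Plane → ℝ} {z u v : Lattice} {φ P Q : ℤ → ℤ → ℝ}
    (h : Coords f z u v φ P Q) {c d : ℤ} (hc : pt z u v c d ∈ core f (box z u v)) :
    c * P 0 0 + d * Q 0 0 ≤ 0 ∧ (c - 1) * P 1 0 + d * Q 1 0 ≤ 0 ∧
      c * P 0 1 + (d - 1) * Q 0 1 ≤ 0 ∧ (c - 1) * P 1 1 + (d - 1) * Q 1 1 ≤ 0 := by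
  have := (mem_core_iff.1 hc).2
  simpa [forall_mem_box, h.cut] using this

/-- A vector of the parallelogram outside the core is cut. -/
theorem Coords.notMem_core {f : Plane → ℝ} {z u v : Lattice} {φ P Q : ℤ → ℤ → ℝ}
    (h : Coords f z u v φ P Q) {c d : ℤ} (hbox : pt z u v c d ∈ box z u v)
    (hc : pt z u v c d ∉ core f (box z u v)) :
    0 < c * P 0 0 + d * Q 0 0 ∨ 0 < (c - 1) * P 1 0 + d * Q 1 0 ∨
      0 < c * P 0 1 + (d - 1) * Q 0 1 ∨ 0 < (c - 1) * P 1 1 + (d - 1) * Q 1 1 := by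
  by_contra! hn
  refine hc (mem_core_iff.2 ⟨hbox, ?_⟩)
  simpa [forall_mem_box, h.cut] using hn

theorem mem_HZ_iff_box {f : Plane → ℝ} {z : Lattice} {U : Matrix (Fin 2) (Fin 2) ℤ} {i : ℤ}
    (hU : |det2 (U.col 0) (U.col 1)| = 1) {w : Lattice} :
    w ∈ HZ f z U i ↔ (∃ c : ℤ, w = pt z (U.col 0) (U.col 1) c i) ∧
      emb w ∈ intrGP f (box z (U.col 0) (U.col 1)) := by
  rw [mem_HZ_iff (by rwa [det_eq_det2]), uset_eq_box]

/-! ### Case 5: three core vectors -/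

/-- The triple case, one direction. -/
theorem prec_of_triple {f : Plane → ℝ} (hconv : ConvexOn ℝ Set.univ f)
    (hdiff : Differentiable ℝ f) {z u v : Lattice}
    (hcore : core f (box z u v) = {z, z + u, z + v}) {B : Set Lattice} {a b : ℤ}
    (hB : B = {z, z + u, z + v, pt z u v a b})
    (hp : emb (pt z u v a b) ∈ intrGP f (box z u v)) :
    Prec f (core f B) (core f (box z u v)) := by
  have hcut : ∀ c ∈ box z u v, ¬ StrictlyCuts f c (pt z u v a b) := fun c hc =>
    not_lt.2 (hp c hc).le
  have hnot : pt z u v a b ∉ box z u v := fun h => by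
    have := hp _ h; simp at this
  have hC : ∀ c ∈ core f (box z u v), c ∈ box z u v := fun c hc => (mem_core_iff.1 hc).1
  refine prec_of_not_cut hconv hdiff ?_ ?_ ⟨pt z u v a b, by simp [hB], fun h => hnot (hC _ h)⟩ ?_
  · rw [hB]; simp
  · rw [hcore, hB]; intro w; simp; tauto
  · intro c hc w hw hwn
    have : w = pt z u v a b := by
      rw [hcore] at hwn; rw [hB] at hw
      simp only [Set.mem_insert_iff, Set.mem_singleton_iff] at hw hwn
      tauto
    rw [this]
    exact hcut c (hC c hc)

/-- The flip keeps the three core vectors and replaces `z + u + v` by a vector that must be shown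
interior. In row `-1` the given interior vector can only be `z + u - v` itself. In row `1` it is `z
+ c u + v` with `c ≤ -1`, and `z - u + v` is on the segment from it to the core vector `z + v`. -/
theorem prec_of_flip5 {f : Plane → ℝ} (hconv : ConvexOn ℝ Set.univ f)
    (hdiff : Differentiable ℝ f) {z : Lattice} {U V : Matrix (Fin 2) (Fin 2) ℤ}
    (hU : |U.det| = 1) (hV : Flip5 f z U V) :
    Prec f (core f (uset z V)) (core f (uset z U)) := by
  rw [det_eq_det2] at hU
  obtain ⟨hcore, i, -, hi, hV⟩ := hV
  obtain ⟨w, hw⟩ := Set.one_le_encard_iff_nonempty.1 hi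
  obtain ⟨⟨c, rfl⟩, hw⟩ := (mem_HZ_iff_box hU).1 hw
  rw [uset_eq_box] at hcore
  rw [uset_eq_box _ U]
  set u := U.col 0
  set v := U.col 1
  obtain ⟨φ, P, Q, hs, hv, hin⟩ := exists_coords hconv hdiff z u v
  have H : Coords f z u v φ P Q := ⟨hs, hv, hin⟩
  have h0 := H.mem_core (c := 0) (d := 0) (by rw [hcore]; simp [pt])
  have h1 := H.mem_core (c := 1) (d := 0) (by rw [hcore]; simp [pt])
  have h2 := H.mem_core (c := 0) (d := 1) (by rw [hcore]; simp [pt])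
  have h3 := H.notMem_core (c := 1) (d := 1) (by rw [box_eq_pt]; simp) (by
    rw [hcore, triple_eq_pt]; simp [pt_eq_iff hU])
  rw [H.intr_iff] at hw
  norm_num at h0 h1 h2 h3
  obtain ⟨a1, a2, a3⟩ := h0
  obtain ⟨b1, b2, b3⟩ := h1
  obtain ⟨c1, c2, c3⟩ := h2
  obtain ⟨d1, d2, d3, d4⟩ := hw
  rcases hV with ⟨rfl, rfl⟩ | ⟨rfl, rfl⟩
  · refine prec_of_triple hconv hdiff hcore (a := -1) (b := 1) ?_ ?_
    · rw [uset_cols]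
      have e1 : z + (-u + v) = pt z u v (-1) 1 := by simp only [pt]; module
      have e2 : z + u + (-u + v) = z + v := by abel
      ext w; simp only [box, e1, e2, Set.mem_insert_iff, Set.mem_singleton_iff]; tauto
    · rw [H.intr_iff]
      norm_num at d1 d2 d3 d4 ⊢
      have hc : c ≤ -1 := by
        by_contra! hc
        rcases (by omega : c = 0 ∨ c = 1 ∨ 2 ≤ c) with rfl | rfl | hc
        · simp at d3
        · simp at d4
        · have hc : (2 : ℝ) ≤ c := by exact_mod_cast hc
          rcases h3 with h3 | h3 | h3 <;> nlinarith
      have hc : (c : ℝ) ≤ -1 := by exact_mod_cast hc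
      refine ⟨?_, ?_, ?_, ?_⟩ <;> nlinarith
  · refine prec_of_triple hconv hdiff hcore (a := 1) (b := -1) ?_ ?_
    · rw [uset_cols]
      have e1 : z + (u - v) = pt z u v 1 (-1) := by simp only [pt]; module
      have e2 : z + (u - v) + v = z + u := by abel
      rw [← e1]
      ext w; simp only [box, e2, Set.mem_insert_iff, Set.mem_singleton_iff]; tauto
    · rw [H.intr_iff]
      norm_num at d1 d2 d3 d4 ⊢
      have hc : c = 1 := by
        by_contra hc
        rcases (by omega : c ≤ 0 ∨ 2 ≤ c) with hc | hc
        · have hc : (c : ℝ) ≤ 0 := by exact_mod_cast hc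
          nlinarith
        · have hc : (2 : ℝ) ≤ c := by exact_mod_cast hc
          nlinarith
      subst hc
      norm_num at d1 d2 d3 d4
      refine ⟨?_, ?_, ?_, ?_⟩ <;> linarith

/-! ### Case 4: an edge, with several interior vectors in a row -/

theorem prec_of_edge {f : Plane → ℝ} (hconv : ConvexOn ℝ Set.univ f)
    (hdiff : Differentiable ℝ f) {A B : Set Lattice} {a b p q : Lattice}
    (hcore : core f A = {a, b}) (hB : B = {a, b, p, q}) (hp : p ∉ core f A)
    (hap : ¬ StrictlyCuts f a p) (hbp : ¬ StrictlyCuts f b p)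
    (haq : ¬ StrictlyCuts f a q) (hbq : ¬ StrictlyCuts f b q) :
    Prec f (core f B) (core f A) := by
  refine prec_of_not_cut hconv hdiff (by rw [hB]; simp) ?_ ⟨p, by simp [hB], hp⟩ ?_
  · rw [hcore, hB]; intro w; simp; tauto
  · intro c hc w hw hwn
    rw [hcore] at hc hwn
    rw [hB] at hw
    simp only [Set.mem_insert_iff, Set.mem_singleton_iff] at hc hw hwn
    rcases hc with rfl | rfl <;> rcases hw with rfl | rfl | rfl | rfl <;> tauto

theorem not_strictlyCuts_of_mem_intrGP {f : Plane → ℝ} {X : Set Lattice} {c w : Lattice}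
    (hw : emb w ∈ intrGP f X) (hc : c ∈ X) : ¬ StrictlyCuts f c w :=
  not_lt.2 (hw c hc).le

theorem notMem_of_mem_intrGP {f : Plane → ℝ} {X : Set Lattice} {w : Lattice}
    (hw : emb w ∈ intrGP f X) : w ∉ X := fun h => by
  have := hw _ h
  simp at this

theorem notMem_core_of_mem_intrGP {f : Plane → ℝ} {X : Set Lattice} {w : Lattice}
    (hw : emb w ∈ intrGP f X) : w ∉ core f X := fun h =>
  notMem_of_mem_intrGP hw (mem_core_iff.1 h).1

theorem intrGP_row_convex {f : Plane → ℝ} {z u v : Lattice} {X : Set Lattice} {a b c i : ℤ}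
    (ha : emb (pt z u v a i) ∈ intrGP f X) (hb : emb (pt z u v b i) ∈ intrGP f X)
    (hac : a ≤ c) (hcb : c ≤ b) : emb (pt z u v c i) ∈ intrGP f X := by
  rcases hac.eq_or_lt with rfl | hlt
  · exact ha
  intro w hw
  have h1 := ha w hw
  have h2 := hb w hw
  simp only [emb_pt, inner_sub_right, inner_add_right, inner_smul_right] at h1 h2 ⊢
  have hac' : (a : ℝ) < c := by exact_mod_cast hlt
  have hcb' : (c : ℝ) ≤ b := by exact_mod_cast hcb
  rcases le_or_gt 0 (inner ℝ (gradient f (emb w)) (emb u)) with h | h <;> nlinarith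

theorem mem_left_of_edge {f : Plane → ℝ} {z u v : Lattice}
    (hcore : core f (box z u v) = {z, z + u}) :
    pt z u v 0 0 ∈ core f (box z u v) ∧ pt z u v 1 0 ∈ core f (box z u v) := by
  rw [hcore]; simp [pt]

/-- Vectors of the interior are cut by no vector of the set, so two neighbours in a row complete the
edge to an improving parallelogram. -/
theorem prec_of_adjacent {f : Plane → ℝ} (hconv : ConvexOn ℝ Set.univ f)
    (hdiff : Differentiable ℝ f) {z u v : Lattice}
    (hcore : core f (box z u v) = {z, z + u}) {k i : ℤ}
    (h1 : emb (pt z u v k i) ∈ intrGP f (box z u v))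
    (h2 : emb (pt z u v (k + 1) i) ∈ intrGP f (box z u v)) :
    Prec f (core f (box z u (k • u + i • v))) (core f (box z u v)) := by
  have e1 : z + (k • u + i • v) = pt z u v k i := by simp only [pt]; module
  have e2 : z + u + (k • u + i • v) = pt z u v (k + 1) i := by simp only [pt]; module
  have m0 : z ∈ box z u v := by simp [box]
  have m1 : z + u ∈ box z u v := by simp [box]
  exact prec_of_edge hconv hdiff hcore (B := box z u (k • u + i • v)) (by rw [box, e1, e2])
    (notMem_core_of_mem_intrGP h1) (not_strictlyCuts_of_mem_intrGP h1 m0)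
    (not_strictlyCuts_of_mem_intrGP h1 m1) (not_strictlyCuts_of_mem_intrGP h2 m0)
    (not_strictlyCuts_of_mem_intrGP h2 m1)

/-- The reflected parallelogram below an edge. -/
theorem prec_of_reflect {f : Plane → ℝ} (hconv : ConvexOn ℝ Set.univ f)
    (hdiff : Differentiable ℝ f) {z u v : Lattice} (hU : |det2 u v| = 1)
    (hcore : core f (box z u v) = {z, z + u})
    (hp : emb (pt z u v 0 (-1)) ∈ intrGP f (box z u v))
    (hr : emb (pt z u v (-1) (-1)) ∈ intrGP f (box z u v))
    {x : Lattice} (hx : ∀ w ∈ box z u v, f (emb x) < f (emb w)) :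
    Prec f (core f (box z u (-v))) (core f (box z u v)) := by
  have e1 : z + -v = pt z u v 0 (-1) := by simp only [pt]; module
  have e2 : z + u + -v = pt z u v 1 (-1) := by simp only [pt]; module
  have hB : box z u (-v) = {pt z u v 0 0, pt z u v 1 0, pt z u v 0 (-1), pt z u v 1 (-1)} := by
    rw [box, e1, e2, pt_zero_zero, pt_one_zero]
  have m0 : z ∈ box z u v := by simp [box]
  have m1 : z + u ∈ box z u v := by simp [box]
  obtain ⟨φ, P, Q, hs, hv, hin⟩ := exists_coords hconv hdiff z u v
  have H : Coords f z u v φ P Q := ⟨hs, hv, hin⟩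
  have h0 := H.mem_core (mem_left_of_edge hcore).1
  have h1 := H.mem_core (mem_left_of_edge hcore).2
  have hp' := (H.intr_iff _ _).1 hp
  have hr' := (H.intr_iff _ _).1 hr
  norm_num at h0 h1 hp' hr'
  obtain ⟨a1, a2, a3⟩ := h0
  obtain ⟨b1, b2, b3⟩ := h1
  obtain ⟨c1, c2, c3, c4⟩ := hp'
  obtain ⟨d1, d2, d3, d4⟩ := hr'
  have h0q : ¬ StrictlyCuts f (pt z u v 0 0) (pt z u v 1 (-1)) := by
    rw [H.cut]; norm_num; linarith
  by_cases h1q : StrictlyCuts f (pt z u v 1 0) (pt z u v 1 (-1))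
  · have hq1 : φ 1 0 < φ 1 (-1) := by simpa [H.val] using h1q.lt hconv hdiff
    rw [H.cut] at h1q
    norm_num at h1q
    have hmono := hs 1 0 1 (-1)
    have hmono' := hs 1 (-1) 1 0
    norm_num at hmono hmono'
    -- If `z + u` cuts `z + u - v` and that vector cut `z - v`, then the three half-planes at `z`,
    -- `z + u` and `z + u - v` would leave no place for `x`. This is checked for rows below, on and
    -- above the edge.
    have hqp : ¬ StrictlyCuts f (pt z u v 1 (-1)) (pt z u v 0 (-1)) := by
      intro h
      rw [H.cut] at h
      norm_num at h
      obtain ⟨a, b, rfl⟩ := exists_pt (z := z) hU x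
      simp only [forall_mem_box, H.val] at hx
      obtain ⟨x1, x2, x3, x4⟩ := hx
      have s1 := hs 0 0 a b
      have s2 := hs 1 0 a b
      have s3 := hs 1 (-1) a b
      norm_num at s1 s2 s3
      rcases (by omega : b ≤ -1 ∨ b = 0 ∨ 1 ≤ b) with hb | rfl | hb
      · have hb : (b : ℝ) ≤ -1 := by exact_mod_cast hb
        have hQ : Q 1 (-1) < 0 := by linarith
        have h5 : 0 ≤ (b + 1) * Q 1 (-1) := mul_nonneg_of_nonpos_of_nonpos (by linarith) hQ.le
        have h6 : (a - 1) * P 1 (-1) < 0 := by linarith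
        have h7 : (0 : ℝ) < a - 1 := by nlinarith
        nlinarith
      · rcases le_or_gt a 0 with ha | ha
        · have ha : (a : ℝ) ≤ 0 := by exact_mod_cast ha
          norm_num at s1; nlinarith
        · have ha : (1 : ℝ) ≤ a := by exact_mod_cast ha
          norm_num at s2; nlinarith
      · have hb : (1 : ℝ) ≤ b := by exact_mod_cast hb
        have h5 : a * P 0 0 + b * Q 0 0 < 0 := by linarith
        have h6 : (a - 1) * P 1 0 + b * Q 1 0 < 0 := by linarith
        -- The second interior vector `(-1, -1)` enters here, through `P 0 0 + Q 0 0 > 0`.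
        have h7 : (b : ℝ) < a := by
          by_contra! h7
          nlinarith
        have h8 : (b : ℝ) + 1 ≤ a := by
          have : b < a := by exact_mod_cast h7
          exact_mod_cast this
        nlinarith
    refine prec_of_mem (r := pt z u v 0 (-1)) ?_ (mem_core_iff.2 ⟨by rw [hB]; simp, ?_⟩)
      (notMem_core_of_mem_intrGP hp) ?_
    · rw [hB, hcore, pair_eq_pt z u v]; intro w; simp; tauto
    · rw [hB]
      rintro w (rfl | rfl | rfl | rfl)
      · rw [pt_zero_zero]; exact not_strictlyCuts_of_mem_intrGP hp m0
      · rw [pt_one_zero]; exact not_strictlyCuts_of_mem_intrGP hp m1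
      · exact not_strictlyCuts_self _ _
      · exact hqp
    · rw [hB]
      rintro d hd w (rfl | rfl | rfl | rfl) hc
      · exact absurd hc ((mem_core_iff.1 hd).2 _ (by rwa [pt_zero_zero]))
      · exact absurd hc ((mem_core_iff.1 hd).2 _ (by rwa [pt_one_zero]))
      · exact hc.lt hconv hdiff
      · exfalso
        rw [hcore, pair_eq_pt z u v] at hd
        rw [H.cut] at hqp
        norm_num at hqp
        rcases hd with rfl | rfl <;> rw [H.cut] at hc <;> norm_num at hc <;> linarith
  · exact prec_of_edge hconv hdiff (p := pt z u v 0 (-1)) (q := pt z u v 1 (-1)) hcore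
      (by rw [hB, pt_zero_zero, pt_one_zero]) (notMem_core_of_mem_intrGP hp)
      (not_strictlyCuts_of_mem_intrGP hp m0) (not_strictlyCuts_of_mem_intrGP hp m1)
      (by rwa [pt_zero_zero] at h0q) (by rwa [pt_one_zero] at h1q)

/-- Let `l` be the position of a second interior vector. If it is farther out on the side of `k`,
convexity makes the neighbour of `k` on that side interior. Otherwise position `0` is interior too,
so minimality gives `k = 0`. The flip then reflects the parallelogram in the edge; row `1` is
excluded because `z + v` is a corner. -/
theorem prec_of_flip4 {f : Plane → ℝ} (hconv : ConvexOn ℝ Set.univ f)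
    (hdiff : Differentiable ℝ f) {z : Lattice} {U V : Matrix (Fin 2) (Fin 2) ℤ}
    (hU : |U.det| = 1) (hV : Flip4 f z U V)
    {x : Lattice} (hx : ∀ w ∈ uset z U, f (emb x) < f (emb w)) :
    Prec f (core f (uset z V)) (core f (uset z U)) := by
  rw [det_eq_det2] at hU
  obtain ⟨hcore, i, hi, hcard, k, hk, hmin, hV⟩ := hV
  obtain ⟨w, hw, hwk⟩ := Set.exists_ne_of_one_lt_encard
    (lt_of_lt_of_le (by norm_num) hcard : 1 < (HZ f z U i).encard)
    (pt z (U.col 0) (U.col 1) k i)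
  rw [mem_HZ_iff_box hU] at hw
  obtain ⟨⟨l, rfl⟩, hl⟩ := hw
  have hmin' : ∀ l : ℤ, emb (pt z (U.col 0) (U.col 1) l i) ∈
      intrGP f (box z (U.col 0) (U.col 1)) → |k| ≤ |l| := fun l hl =>
    hmin l ((mem_HZ_iff_box hU).2 ⟨⟨l, rfl⟩, hl⟩)
  replace hk : emb (pt z (U.col 0) (U.col 1) k i) ∈ intrGP f (box z (U.col 0) (U.col 1)) :=
    ((mem_HZ_iff_box hU).1 hk).2
  replace hwk : l ≠ k := by rintro rfl; exact hwk rfl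
  rw [uset_eq_box] at hcore hx
  rw [uset_eq_box _ U]
  set u := U.col 0
  set v := U.col 1
  have hkl := hmin' l hl
  rcases hV with ⟨hk0, rfl⟩ | ⟨hk0, rfl⟩
  · rw [uset_cols]
    by_cases hlk : k < l
    · exact prec_of_adjacent hconv hdiff hcore hk (intrGP_row_convex hk hl (by omega) (by omega))
    · have hl0 : l ≤ 0 := by
        rw [abs_of_nonneg hk0] at hkl
        by_contra! h
        rw [abs_of_pos h] at hkl
        omega
      have h0 := hmin' 0 (intrGP_row_convex hl hk hl0 hk0)
      have hk0 : k = 0 := by simpa using h0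
      subst hk0
      rcases hi with rfl | rfl
      · rw [zero_smul, zero_add, neg_one_smul]
        exact prec_of_reflect hconv hdiff hU hcore hk
          (intrGP_row_convex hl hk (by omega) (by omega)) hx
      · exact absurd (by rw [pt_zero_one]; simp [box]) (notMem_of_mem_intrGP hk)
  · rw [uset_cols]
    have hlk : l < k := by
      by_contra! h
      have hl0 : 0 ≤ l := by
        rw [abs_of_neg (by omega)] at hkl
        by_contra! h
        rw [abs_of_neg h] at hkl
        omega
      have h0 := hmin' 0 (intrGP_row_convex hk hl (by omega) hl0)
      have hk0 : k = 0 := by simpa using h0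
      omega
    exact prec_of_adjacent hconv hdiff hcore (intrGP_row_convex hl hk (by omega) (by omega))
      (by rwa [sub_add_cancel])

/-! ### Case 3: an edge, with one interior vector in a row -/

theorem two_mul_eq_of_row {n m M : ℤ} (hn : 2 ≤ n) (hM : 1 ≤ M) (h1 : M * (n - 1) < 2 * (n - m))
    (h2 : n ≤ 2 * m) : n = 2 * m := by
  -- By `h2` the right side of `h1` is at most `n`, while `M ≥ 2` would make the left side at least
  -- `2n - 2`.
  have hM1 : M = 1 := by
    by_contra h
    have : 2 ≤ M := by omega
    nlinarith
  subst hM1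
  omega

/-- A vector on the far side of the edge is cut. -/
theorem no_opposite_row {A B C D : ℝ} {n μ : ℤ} (hn : 1 ≤ n) (hB : 0 < B)
    (hC : 0 < C) (hD : 0 < D) (h1 : -n * A + μ * (A + B) < 0)
    (h2 : -n * C + μ * (C + D) - D < 0) (hAB : A + B ≤ 0) : False := by
  have hn' : (1 : ℝ) ≤ n := by exact_mod_cast hn
  have hμ : n < μ := by
    by_contra! h
    have h' : (μ : ℝ) ≤ n := by exact_mod_cast h
    nlinarith
  have hμ' : (n : ℝ) + 1 ≤ μ := by exact_mod_cast hμ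
  nlinarith

/-- A bound on the row number `n` from a weak cut by the vector `(0, 1)`. -/
theorem row_bound_zero {P Q : ℝ} {k n m : ℤ} (hn : 2 ≤ n) (hP : P < 0)
    (h1 : 0 ≤ (k - 1) * P - 2 * Q) (h2 : (n * k - m) * P + (-n - 1) * Q < 0) :
    (1 - k) * (n - 1) < 2 * (n - m) := by
  have hn' : (2 : ℝ) ≤ n := by exact_mod_cast hn
  have h3 : (n + 1) * (2 * Q) ≤ (n + 1) * ((k - 1) * P) := by
    apply mul_le_mul_of_nonneg_left <;> linarith
  have h4 : ((2 * (n - m) - (1 - k) * (n - 1) : ℤ) : ℝ) * P < 0 := by push_cast; nlinarith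
  have h5 : (0 : ℝ) < ((2 * (n - m) - (1 - k) * (n - 1) : ℤ) : ℝ) := by
    by_contra! h
    nlinarith
  have : (0 : ℤ) < 2 * (n - m) - (1 - k) * (n - 1) := by exact_mod_cast h5
  linarith

/-- A bound on the row number `n` from a weak cut by the vector `(1, 1)`. -/
theorem row_bound_one {P Q : ℝ} {k n m : ℤ} (hn : 2 ≤ n) (hP : P < 0)
    (h1 : 0 ≤ (k - 2) * P - 2 * Q) (h2 : (n * k - m - 1) * P + (-n - 1) * Q < 0) :
    (-k) * (n - 1) < 2 * (n - m) := by
  have hn' : (2 : ℝ) ≤ n := by exact_mod_cast hn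
  have h3 : (n + 1) * (2 * Q) ≤ (n + 1) * ((k - 2) * P) := by
    apply mul_le_mul_of_nonneg_left <;> linarith
  have h4 : ((2 * (n - m) - (-k) * (n - 1) : ℤ) : ℝ) * P < 0 := by push_cast; nlinarith
  have h5 : (0 : ℝ) < ((2 * (n - m) - (-k) * (n - 1) : ℤ) : ℝ) := by
    by_contra! h
    nlinarith
  have : (0 : ℤ) < 2 * (n - m) - (-k) * (n - 1) := by exact_mod_cast h5
  linarith

/-- Subtracting the inequalities gives `P < 0`, hence `0 < k ≤ 1`. -/
theorem eq_one_of_weak {P : ℝ} {k : ℤ} (h : 0 ≤ (k - 1) * P) (h' : k * P < 0) : k = 1 := by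
  have hP : P < 0 := by linarith
  have h1 : (0 : ℝ) < k := by
    by_contra! hk
    nlinarith
  have h2 : (k : ℝ) ≤ 1 := by
    by_contra! hk
    nlinarith
  have h1 : 0 < k := by exact_mod_cast h1
  have h2 : k ≤ 1 := by exact_mod_cast h2
  omega

/-- In coordinates: the only better vectors are the multiples of `p - p'`. -/
theorem Coords.antidiagonal {f : Plane → ℝ} {z u v : Lattice} {φ P Q : ℤ → ℤ → ℝ}
    (H : Coords f z u v φ P Q) (hU : |det2 u v| = 1)
    (hcore : core f (box z u v) = {z, z + u}) {k i n m : ℤ} (hi : i = -1 ∨ i = 1)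
    (hp : emb (pt z u v k i) ∈ intrGP f (box z u v))
    (huniq : emb (pt z u v (k - 1) i) ∉ intrGP f (box z u v))
    (hn : 2 ≤ n)
    (hx : ∀ w ∈ box z u v, f (emb (pt z u v (n * k - m) (n * i))) < f (emb w))
    (hx' : f (emb (pt z u v (n * k - m) (n * i))) < f (emb (pt z u v (1 - k) (-i))))
    (h0 : StrictlyCuts f (pt z u v 0 0) (pt z u v (1 - k) (-i)))
    (h1 : StrictlyCuts f (pt z u v (1 - k) (-i)) (pt z u v 1 0))
    (h2 : StrictlyCuts f (pt z u v (1 - k) (-i)) (pt z u v k i)) : n = 2 * m := by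
  have c0 := H.mem_core (mem_left_of_edge hcore).1
  have c1 := H.mem_core (mem_left_of_edge hcore).2
  have hp' := (H.intr_iff _ _).1 hp
  have hpbox : ∀ a b : ℤ, pt z u v a b ∈ box z u v → k = a → i = b → False := by
    rintro a b hab rfl rfl; exact notMem_of_mem_intrGP hp hab
  have hqbox : pt z u v (1 - k) (-i) ∉ box z u v := fun h =>
    (mem_core_iff.1 (mem_left_of_edge hcore).2).2 _ h h1
  simp only [forall_mem_box, H.val] at hx
  rw [H.val, H.val] at hx'
  rw [H.cut] at h0 h1 h2
  have e1 := H.sub (1 - k) (-i) 1 0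
  have e2 := H.sub 1 0 (1 - k) (-i)
  have e3 := H.sub 0 0 (1 - k) (-i)
  have e4 := H.sub (1 - k) (-i) 0 0
  have sq := H.sub (1 - k) (-i) (n * k - m) (n * i)
  have s01 := H.sub 0 1 (n * k - m) (n * i)
  have s11 := H.sub 1 1 (n * k - m) (n * i)
  rw [H.intr_iff] at huniq
  obtain ⟨x1, x2, x3, x4⟩ := hx
  push_cast at *
  norm_num at c0 c1
  obtain ⟨a1, a2, a3⟩ := c0
  obtain ⟨b1, b2, b3⟩ := c1
  obtain ⟨p1, p2, p3, p4⟩ := hp'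
  have hn' : (2 : ℝ) ≤ n := by exact_mod_cast hn
  -- the reflected vector bounds `n`
  have hnm : n ≤ 2 * m := by
    -- `C` and `D` are the derivatives at `p'` along `p - z` and `p' - z`. Since `u = (p - z) + (p'
    -- - z)`, the better vector minus `p'` equals `(n - m)(p - z) - (m + 1)(p' - z)`, which must
    -- descend although `C > D > 0`.
    set C := k * P (1 - k) (-i) + i * Q (1 - k) (-i) with hC
    set D := (1 - k) * P (1 - k) (-i) - i * Q (1 - k) (-i) with hD
    have hC0 : 0 < C := by linarith
    have hDC : D < C := by linarith
    have hD0 : 0 < D := by linarith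
    have h5 : (n - m) * C < (m + 1) * D := by
      have : (n - m) * C - (m + 1) * D = (n * k - m - (1 - k)) * P (1 - k) (-i) +
        (n * i - -i) * Q (1 - k) (-i) := by rw [hC, hD]; ring
      linarith
    by_contra! h
    have h6 : (m : ℝ) + m + 1 ≤ n := by exact_mod_cast (by omega : m + m + 1 ≤ n)
    rcases le_or_gt 0 ((m : ℝ) + 1) with h7 | h7
    · nlinarith
    · have h8 : (m : ℝ) + 1 < 0 := h7
      nlinarith
  have hE : 0 < k * P 1 0 + i * Q 1 0 := by linarith
  -- The left neighbour of `p` is not interior, yet it satisfies the strict inequalities of `z` and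
  -- `z + u`. So the inequality of `z + v` or of `z + u + v` fails there.
  have hweak : 0 ≤ (k - 1) * P 0 1 + (i - 1) * Q 0 1 ∨
      0 ≤ (k - 1 - 1) * P 1 1 + (i - 1) * Q 1 1 := by
    by_contra! hcon
    exact huniq ⟨by linarith, by linarith, hcon.1, hcon.2⟩
  rcases hi with rfl | rfl
  · rcases hweak with h | h <;> norm_num at h p3 p4 s01 s11 x3 x4
    · have hP : P 0 1 < 0 := by linarith
      have hk1 : k ≤ 1 := by
        by_contra! hk
        have : (2 : ℝ) ≤ k := by exact_mod_cast hk
        nlinarith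
      have hk1 : k ≤ 0 := by
        by_contra! hk
        obtain rfl : k = 1 := by omega
        exact hqbox (by rw [box_eq_pt]; norm_num)
      exact two_mul_eq_of_row hn (by omega : 1 ≤ 1 - k)
        (row_bound_zero (Q := Q 0 1) hn hP (by linarith) (by linarith)) hnm
    · have hP : P 1 1 < 0 := by linarith
      have hk1 : k ≤ 0 := by
        by_contra! hk
        have : (1 : ℝ) ≤ k := by exact_mod_cast hk
        nlinarith
      have hk1 : k ≤ -1 := by
        by_contra! hk
        obtain rfl : k = 0 := by omega
        exact hqbox (by rw [box_eq_pt]; norm_num)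
      exact two_mul_eq_of_row hn (by omega : 1 ≤ -k)
        (row_bound_one (Q := Q 1 1) hn hP (by linarith) (by linarith)) hnm
  · exfalso
    norm_num at p3 p4 hweak
    rcases hweak with h | h
    · obtain rfl := eq_one_of_weak h p3
      exact hpbox 1 1 (by rw [box_eq_pt]; simp) rfl rfl
    · have hk := eq_one_of_weak (k := k - 1) (by push_cast; exact h) (by push_cast; exact p4)
      obtain rfl : k = 2 := by omega
      have hnc := H.notMem_core (c := 1) (d := 1) (by rw [box_eq_pt]; simp) (by
        rw [hcore, pair_eq_pt z u v]; simp [pt_eq_iff hU])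
      have e5 := H.sub 0 1 1 1
      have e6 := H.sub 1 1 0 1
      clear sq s01 s11 e3 e4 x1 x2 x3 x4 hx'
      norm_num at hnc e5 e6 p4 h0 p1 p2 hE
      rcases hnc with h | h | h <;> linarith

/-- The parallelogram with the edge as a diagonal, when `z` cuts the reflected vector. -/
theorem prec_or_antidiagonal {f : Plane → ℝ} (hconv : ConvexOn ℝ Set.univ f)
    (hdiff : Differentiable ℝ f) {z u v : Lattice} (hU : |det2 u v| = 1)
    (hcore : core f (box z u v) = {z, z + u}) {k i : ℤ} (hi : i = -1 ∨ i = 1)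
    (hp : emb (pt z u v k i) ∈ intrGP f (box z u v))
    (huniq : ∀ c : ℤ, emb (pt z u v c i) ∈ intrGP f (box z u v) → c = k)
    {x : Lattice} (hx : ∀ w ∈ box z u v, f (emb x) < f (emb w))
    (h0 : StrictlyCuts f (pt z u v 0 0) (pt z u v (1 - k) (-i))) {B : Set Lattice}
    (hB : B = {pt z u v 0 0, pt z u v 1 0, pt z u v k i, pt z u v (1 - k) (-i)}) :
    Prec f (core f B) (core f (box z u v)) ∨
      (core f B = {z} ∧ f (emb (pt z u v (2 * k - 1) (2 * i))) < f (emb z) ∧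
        f (emb z) < f (emb (z + u))) := by
  obtain ⟨φ, P, Q, hs, hv, hin⟩ := exists_coords hconv hdiff z u v
  have H : Coords f z u v φ P Q := ⟨hs, hv, hin⟩
  have m0 : pt z u v 0 0 ∈ box z u v := by simp [box, pt]
  have m1 : pt z u v 1 0 ∈ box z u v := by simp [box, pt]
  have hsub : core f (box z u v) ⊆ B := by
    rw [hB, hcore, pair_eq_pt z u v]; intro w; simp; tauto
  have hmem0 := (mem_left_of_edge hcore).1
  have hmem1 := (mem_left_of_edge hcore).2
  have c0 := H.mem_core hmem0
  have c1 := H.mem_core hmem1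
  have hp' := (H.intr_iff _ _).1 hp
  have lt0 : φ 0 0 < φ (1 - k) (-i) := by simpa [H.val] using h0.lt hconv hdiff
  have h0' := h0
  rw [H.cut] at h0'
  have e3 := hs 0 0 (1 - k) (-i)
  have e4 := hs (1 - k) (-i) 0 0
  push_cast at c0 c1 h0' e3 e4
  norm_num at c0 c1
  obtain ⟨a1, a2, a3⟩ := c0
  obtain ⟨b1, b2, b3⟩ := c1
  obtain ⟨p1, p2, p3, p4⟩ := hp'
  have hD : 0 < (1 - k) * P (1 - k) (-i) - i * Q (1 - k) (-i) := by linarith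
  have hp'0 : ¬ StrictlyCuts f (pt z u v (1 - k) (-i)) (pt z u v 0 0) := by
    rw [H.cut]; push_cast; linarith
  -- the vector `p` improves the core as soon as it is not cut and lies below the dropped vectors
  have improve : ¬ StrictlyCuts f (pt z u v (1 - k) (-i)) (pt z u v k i) →
      (StrictlyCuts f (pt z u v (1 - k) (-i)) (pt z u v 1 0) → φ k i < φ 1 0) →
      Prec f (core f B) (core f (box z u v)) := by
    intro hcp hcl
    refine prec_of_mem hsub (r := pt z u v k i) (mem_core_iff.2 ⟨by rw [hB]; simp, ?_⟩)
      (notMem_core_of_mem_intrGP hp) ?_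
    · rw [hB]
      rintro w (rfl | rfl | rfl | rfl)
      · exact not_strictlyCuts_of_mem_intrGP hp m0
      · exact not_strictlyCuts_of_mem_intrGP hp m1
      · exact not_strictlyCuts_self _ _
      · exact hcp
    · rw [hB]
      rintro d hd w (rfl | rfl | rfl | rfl) hc
      · exact absurd hc ((mem_core_iff.1 hd).2 _ m0)
      · exact absurd hc ((mem_core_iff.1 hd).2 _ m1)
      · exact hc.lt hconv hdiff
      · rw [hcore, pair_eq_pt z u v] at hd
        rcases hd with rfl | rfl
        · exact absurd hc hp'0
        · rw [H.val, H.val]; exact hcl hc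
  by_cases h1 : StrictlyCuts f (pt z u v (1 - k) (-i)) (pt z u v 1 0)
  swap
  · left
    refine improve ?_ (fun h => absurd h h1)
    rw [H.cut] at h1 ⊢
    push_cast at h1 ⊢
    -- `p - p' = (z - p') + (z + u - p')`, and neither summand ascends at `p'`.
    linarith
  have lt1 : φ (1 - k) (-i) < φ 1 0 := by simpa [H.val] using h1.lt hconv hdiff
  have h1' := h1
  rw [H.cut] at h1'
  push_cast at h1'
  obtain ⟨a, b, c, j, n, m, rfl, hj, hn, hm, hmn, hnc, hnb, hc⟩ :=
    exists_mem_intrGP hconv hdiff hU (by rwa [pt_zero_zero] at hmem0)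
      (by rwa [pt_one_zero] at hmem1) hx
  have hx0 : φ a b < φ 0 0 := by simpa [H.val] using hx _ m0
  have hx1 : φ a b < φ 1 0 := by simpa [H.val] using hx _ m1
  have hn' : (0 : ℝ) < n := by exact_mod_cast hn
  have hm' : (0 : ℝ) ≤ m := by exact_mod_cast hm
  have hmn' : (m : ℝ) + 1 ≤ n := by exact_mod_cast hmn
  have hji : j = i := by
    by_contra hne
    obtain rfl : j = -i := by omega
    subst hnb
    have s0 := hs 0 0 a (n * -i)
    have s1 := hs (1 - k) (-i) a (n * -i)
    have ha : (a : ℝ) = -n * k + (a + n * k : ℤ) := by push_cast; ring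
    push_cast at s0 s1
    -- With `μ = a + n k` the better vector is `z - n(p - z) + μ u`. `A`, `B` are the derivatives at
    -- `z` along `p - z` and `p' - z`, and `C`, `D` those at `p'`.
    refine no_opposite_row (A := k * P 0 0 + i * Q 0 0) (B := (1 - k) * P 0 0 - i * Q 0 0)
      (C := k * P (1 - k) (-i) + i * Q (1 - k) (-i))
      (D := (1 - k) * P (1 - k) (-i) - i * Q (1 - k) (-i)) (n := n) (μ := a + n * k) (by omega)
      (by linarith) (by linarith) hD ?_ ?_ (by linarith)
    · push_cast; linarith
    · push_cast; linarith
  subst hji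
  obtain rfl := huniq c hc
  obtain rfl : a = n * c - m := by omega
  subst hnb
  -- If `p'` cuts `p`, then `p'` removes both `p` and `z + u`, and `z` removes `p'`: the core
  -- collapses to `{z}`.
  by_cases h2 : StrictlyCuts f (pt z u v (1 - c) (-j)) (pt z u v c j)
  · right
    have lt2 : φ (1 - c) (-j) < φ c j := by simpa [H.val] using h2.lt hconv hdiff
    have hn2 : 2 ≤ n := by
      by_contra! h
      obtain rfl : n = 1 := by omega
      obtain rfl : m = 0 := by omega
      norm_num at hx0
      linarith
    have hnm : n = 2 * m := H.antidiagonal hU hcore hi hp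
      (fun h => by have := huniq _ h; omega) hn2 hx
      (by rw [H.val, H.val]; linarith) h0 h1 h2
    constructor
    · apply Set.Subset.antisymm
      · intro w hw
        obtain ⟨hwB, hwc⟩ := mem_core_iff.1 hw
        have mp : pt z u v (1 - c) (-j) ∈ B := by rw [hB]; simp
        have mz : pt z u v 0 0 ∈ B := by rw [hB]; simp
        rw [hB] at hwB
        rcases hwB with rfl | rfl | rfl | rfl
        · exact pt_zero_zero z u v
        · exact absurd h1 (hwc _ mp)
        · exact absurd h2 (hwc _ mp)
        · exact absurd h0 (hwc _ mz)
      · rintro w rfl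
        rw [← pt_zero_zero w u v]
        refine mem_core_iff.2 ⟨by rw [hB]; simp, ?_⟩
        rw [hB]
        rintro d (rfl | rfl | rfl | rfl)
        · exact not_strictlyCuts_self _ _
        · exact (mem_core_iff.1 hmem0).2 _ m1
        · intro h
          have := h.lt hconv hdiff
          rw [H.val, H.val] at this
          linarith
        · exact hp'0
    · rw [← congrArg (fun w => f (emb w)) (pt_zero_zero z u v),
        ← congrArg (fun w => f (emb w)) (pt_one_zero z u v)]
      simp only [H.val]
      refine ⟨?_, lt0.trans lt1⟩
      -- Now the better vector is `z + m(p - p')` with `m ≥ 1`. By convexity along this line `z + (p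
      -- - p')` is already better than `z`.
      subst hnm
      have s1 := hs (2 * c - 1) (2 * j) (2 * m * c - m) (2 * m * j)
      have s2 := hs (2 * c - 1) (2 * j) 0 0
      push_cast at s1 s2
      have hm1 : (1 : ℝ) ≤ m := by
        have : 1 ≤ m := by omega
        exact_mod_cast this
      set t := (2 * c - 1) * P (2 * c - 1) (2 * j) + 2 * j * Q (2 * c - 1) (2 * j)
      have s1' : φ (2 * c - 1) (2 * j) + (m - 1) * t ≤ φ (2 * m * c - m) (2 * m * j) := by
        refine le_trans (le_of_eq ?_) s1
        simp only [t]; ring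
      have s2' : φ (2 * c - 1) (2 * j) - t ≤ φ 0 0 := by
        refine le_trans (le_of_eq ?_) s2
        simp only [t]; ring
      by_contra! h
      nlinarith
  · left
    refine improve h2 (fun _ => ?_)
    -- `p` is the mean of the better vector, `z + u` and `z` with weights `1/n`, `m/n` and `(n - 1 -
    -- m)/n`, so its value is below that of `z + u`.
    have s1 := hs c j (n * c - m) (n * j)
    have s2 := hs c j 1 0
    have s3 := hs c j 0 0
    push_cast at s1 s2 s3
    by_contra! h
    have w2 := mul_le_mul_of_nonneg_left s2 hm'
    have w3 := mul_le_mul_of_nonneg_left s3 (by linarith : 0 ≤ (n : ℝ) - 1 - m)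
    have w4 : (n - 1 - m) * φ 0 0 ≤ (n - 1 - m) * φ 1 0 :=
      mul_le_mul_of_nonneg_left (by linarith) (by linarith)
    nlinarith

/-- The outcome of the third case: an improvement, or a parallelogram with a single core vector
for which the next step improves. -/
theorem prec_of_flip3 {f : Plane → ℝ} (hconv : ConvexOn ℝ Set.univ f)
    (hdiff : Differentiable ℝ f) {z : Lattice} {U V : Matrix (Fin 2) (Fin 2) ℤ}
    (hU : |U.det| = 1) (hV : Flip3 f z U V)
    {x : Lattice} (hx : ∀ w ∈ uset z U, f (emb x) < f (emb w)) :
    Prec f (core f (uset z V)) (core f (uset z U)) ∨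
      ∃ z' p q : Lattice, uset z V = box z' p q ∧ |det2 p q| = 1 ∧
        core f (box z' p q) = {z'} ∧ ¬ StrictlyCuts f z' (z' + p) ∧ StrictlyCuts f z' (z' + q) ∧
        ∀ w ∈ core f (uset z U), f (emb (z' + (p - q))) < f (emb w) := by
  rw [det_eq_det2] at hU
  obtain ⟨hcore, i, hi, hcard, k, hk, rfl⟩ := hV
  have huniq : ∀ c : ℤ, emb (pt z (U.col 0) (U.col 1) c i) ∈
      intrGP f (box z (U.col 0) (U.col 1)) → c = k := by
    intro c hc
    obtain ⟨w, hw⟩ := Set.encard_eq_one.1 hcard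
    have h1 : pt z (U.col 0) (U.col 1) c i ∈ HZ f z U i := (mem_HZ_iff_box hU).2 ⟨⟨c, rfl⟩, hc⟩
    have h2 : pt z (U.col 0) (U.col 1) k i ∈ HZ f z U i := hk
    rw [hw, Set.mem_singleton_iff] at h1 h2
    exact ((pt_eq_iff hU).1 (h1.trans h2.symm)).1
  replace hk : emb (pt z (U.col 0) (U.col 1) k i) ∈ intrGP f (box z (U.col 0) (U.col 1)) :=
    ((mem_HZ_iff_box hU).1 hk).2
  rw [uset_eq_box] at hcore hx
  rw [uset_eq_box _ U, uset_cols]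
  set u := U.col 0
  set v := U.col 1
  have m0 : pt z u v 0 0 ∈ box z u v := by simp [box, pt]
  have m1 : pt z u v 1 0 ∈ box z u v := by simp [box, pt]
  set p := k • u + i • v with hp
  have e1 : z + p = pt z u v k i := by simp only [p, pt]; module
  have e2 : z + (-((k - 1) • u) - i • v) = pt z u v (1 - k) (-i) := by simp only [pt]; module
  have e3 : z + p + (-((k - 1) • u) - i • v) = z + u := by simp only [p]; module
  have hB : box z p (-((k - 1) • u) - i • v) =
      {pt z u v 0 0, pt z u v 1 0, pt z u v k i, pt z u v (1 - k) (-i)} := by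
    rw [box, e3, e1, e2, pt_zero_zero, pt_one_zero]
    ext w; simp only [Set.mem_insert_iff, Set.mem_singleton_iff]; tauto
  have hmem0 := (mem_left_of_edge hcore).1
  have hmem1 := (mem_left_of_edge hcore).2
  have hdet : |det2 p (-((k - 1) • u) - i • v)| = 1 := by
    have : det2 p (-((k - 1) • u) - i • v) = -i * det2 u v := by
      simp only [det2, p, Pi.add_apply, Pi.sub_apply, Pi.neg_apply, Pi.smul_apply, smul_eq_mul]
      ring
    rw [this, abs_mul, hU]
    rcases hi with rfl | rfl <;> norm_num
  by_cases h0 : StrictlyCuts f (pt z u v 0 0) (pt z u v (1 - k) (-i))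
  · refine (prec_or_antidiagonal hconv hdiff hU hcore hi hk huniq hx h0 hB).imp id ?_
    rintro ⟨h1, h2, h3⟩
    refine ⟨z, p, -((k - 1) • u) - i • v, rfl, hdet, h1, ?_, ?_, ?_⟩
    · rw [e1]; exact not_strictlyCuts_of_mem_intrGP hk (by simp [box])
    · rw [e2]; rwa [pt_zero_zero] at h0
    · have e4 : z + (p - (-((k - 1) • u) - i • v)) = pt z u v (2 * k - 1) (2 * i) := by
        simp only [p, pt]; module
      rw [hcore, e4]
      rintro w (rfl | rfl)
      · exact h2
      · exact h2.trans h3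
  by_cases h1 : StrictlyCuts f (pt z u v 1 0) (pt z u v (1 - k) (-i))
  -- Traverse the edge backwards: `z` and `z + u` change places and `k` becomes `1 - k`.
  · have hflip : ∀ a b : ℤ, pt (z + u) (-u) v a b = pt z u v (1 - a) b := by
      intro a b; simp only [pt]; module
    have hbox : box (z + u) (-u) v = box z u v := by
      rw [box_eq_pt, box_eq_pt]
      simp only [hflip]
      norm_num
      ext w; simp only [Set.mem_insert_iff, Set.mem_singleton_iff]; tauto
    have e5 : z + u + -u = z := by abel
    have hcore' : core f (box (z + u) (-u) v) = {z + u, z + u + -u} := by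
      rw [hbox, hcore, e5, Set.pair_comm]
    have hU' : |det2 (-u) v| = 1 := by
      have : det2 (-u) v = - det2 u v := by
        simp only [det2, Pi.neg_apply]; ring
      rw [this, abs_neg, hU]
    have := prec_or_antidiagonal hconv hdiff hU' hcore' (k := 1 - k) (i := i) hi
      (by rw [hflip, hbox]; simpa using hk)
      (fun c hc => by rw [hflip, hbox] at hc; have := huniq _ hc; omega)
      (by rwa [hbox]) (by rw [hflip, hflip]; simpa using h1)
      (B := box z p (-((k - 1) • u) - i • v)) (by
        rw [hB]; simp only [hflip]; norm_num
        ext w; simp only [Set.mem_insert_iff, Set.mem_singleton_iff]; tauto)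
    rw [hbox] at this
    refine this.imp id ?_
    rintro ⟨h2, h3, h4⟩
    have e6 : z + u + -p = pt z u v (1 - k) (-i) := by simp only [p, pt]; module
    have e7 : z + u + -(-((k - 1) • u) - i • v) = pt z u v k i := by simp only [pt]; module
    have e8 : z + u + -p + -(-((k - 1) • u) - i • v) = z := by simp only [p]; module
    have e9 : z + u + (-(-((k - 1) • u) - i • v) - -p) =
        pt (z + u) (-u) v (2 * (1 - k) - 1) (2 * i) := by simp only [p, pt]; module
    have hbox2 : box z p (-((k - 1) • u) - i • v) =
        box (z + u) (-(-((k - 1) • u) - i • v)) (-p) := by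
      rw [hB, box, add_right_comm _ (-(-((k - 1) • u) - i • v)), e8, e7, e6, pt_zero_zero,
        pt_one_zero]
      ext w; simp only [Set.mem_insert_iff, Set.mem_singleton_iff]; tauto
    refine ⟨z + u, -(-((k - 1) • u) - i • v), -p, hbox2, ?_, hbox2 ▸ h2, ?_, ?_, ?_⟩
    · have : det2 (-(-((k - 1) • u) - i • v)) (-p) = - det2 p (-((k - 1) • u) - i • v) := by
        simp only [det2, Pi.neg_apply]; ring
      rw [this, abs_neg, hdet]
    · rw [e7]; exact not_strictlyCuts_of_mem_intrGP hk (by simp [box])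
    · rw [e6]; rwa [pt_one_zero] at h1
    · rw [hcore, e9]
      rw [e5] at h4
      rintro w (rfl | rfl)
      · exact h3.trans h4
      · exact h3
  · left
    rw [pt_zero_zero] at h0
    rw [pt_one_zero] at h1
    exact prec_of_edge hconv hdiff hcore (by rw [hB, pt_zero_zero, pt_one_zero])
      (notMem_core_of_mem_intrGP hk) (not_strictlyCuts_of_mem_intrGP hk (by simp [box]))
      (not_strictlyCuts_of_mem_intrGP hk (by simp [box])) h0 h1

/-! ### Case 2: the core is a diagonal -/

theorem isConnectedSet_of_pair {f : Plane → ℝ} {z p q : Lattice} (h : |det2 p q| = 1)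
    (hcore : core f (box z p q) = {z, z + p}) : IsConnectedSet f (box z p q) := by
  have hz : z ∈ core f (box z p q) := by rw [hcore]; simp
  have hcard : (core f (box z p q)).encard = 2 := by
    rw [hcore]
    exact Set.encard_pair (by simpa using (ne_zero_of_det2 h).1)
  refine ⟨z, cols p q, isLabelling_cols h, ⟨?_, ?_, ?_⟩, ?_⟩
  · rw [uset_cols]; exact hz.2
  · intro _; left; simpa [uset_cols] using hcore
  · intro h3; rw [uset_cols, hcard] at h3; norm_num at h3
  · rw [hcore]; simp

theorem isConnectedSet_of_triple {f : Plane → ℝ} {z p q : Lattice} (h : |det2 p q| = 1)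
    (hcore : core f (box z p q) = {z, z + p, z + q}) : IsConnectedSet f (box z p q) := by
  have hz : z ∈ core f (box z p q) := by rw [hcore]; simp
  have hcard : (core f (box z p q)).encard = 3 := by
    rw [hcore, triple_eq_pt]
    refine Set.encard_eq_three.2 ⟨_, _, _, ?_, ?_, ?_, rfl⟩ <;> simp [pt_eq_iff h]
  refine ⟨z, cols p q, isLabelling_cols h, ⟨?_, ?_, ?_⟩, ?_⟩
  · rw [uset_cols]; exact hz.2
  · intro h3; rw [uset_cols, hcard] at h3; norm_num at h3
  · intro _; simpa [uset_cols] using hcore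
  · rw [hcore]; intro w; simp; tauto

theorem IsConnectedSet.exists_ne {f : Plane → ℝ} {A : Set Lattice} (h : IsConnectedSet f A) :
    ∃ a ∈ core f A, ∃ b ∈ core f A, a ≠ b := by
  obtain ⟨z, U, ⟨hU, -⟩, -, hsub⟩ := h
  refine ⟨z, hsub (by simp), z + U.col 0, hsub (by simp), ?_⟩
  rw [det_eq_det2] at hU
  simpa using (ne_zero_of_det2 hU).1

/-- The sheared parallelogram in coordinates. -/
theorem box_shear (z u v : Lattice) :
    box z u (u + v) = {pt z u v 0 0, pt z u v 1 0, pt z u v 1 1, pt z u v 2 1} := by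
  have e1 : z + (u + v) = pt z u v 1 1 := by simp only [pt]; module
  have e2 : z + u + (u + v) = pt z u v 2 1 := by simp only [pt]; module
  rw [box, e1, e2, pt_zero_zero, pt_one_zero]

/-- The data of a core that is a diagonal. -/
structure DiagCore (f : Plane → ℝ) (z u v : Lattice) : Prop where
  det : |det2 u v| = 1
  core_eq : core f (box z u v) = {z, z + u + v}
  left : StrictlyCuts f z (z + u)
  right : StrictlyCuts f (z + u + v) (z + v)

section
variable {f : Plane → ℝ} {z u v : Lattice}

theorem DiagCore.cut_left (h : DiagCore f z u v) :
    StrictlyCuts f (pt z u v 0 0) (pt z u v 1 0) := by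
  rw [pt_zero_zero, pt_one_zero]; exact h.left

theorem DiagCore.cut_right (h : DiagCore f z u v) :
    StrictlyCuts f (pt z u v 1 1) (pt z u v 0 1) := by
  rw [pt_one_one, pt_zero_one]; exact h.right

theorem DiagCore.mem (h : DiagCore f z u v) :
    pt z u v 0 0 ∈ core f (box z u v) ∧ pt z u v 1 1 ∈ core f (box z u v) := by
  rw [h.core_eq, diag_eq_pt]; simp

/-- From `z + u + v` the vector `z + 2u + v` lies opposite to `z + v`, which is cut. -/
theorem DiagCore.not_cut_right (hconv : ConvexOn ℝ Set.univ f) (hdiff : Differentiable ℝ f)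
    (h : DiagCore f z u v) : ¬ StrictlyCuts f (pt z u v 1 1) (pt z u v 2 1) := by
  obtain ⟨φ, P, Q, hs, hv, hin⟩ := exists_coords hconv hdiff z u v
  have H : Coords f z u v φ P Q := ⟨hs, hv, hin⟩
  have := h.cut_right
  rw [H.cut] at this ⊢
  norm_num at this ⊢
  exact this.le

/-- In the sheared parallelogram only the new vector can cut a vector of the old core. -/
theorem eq_of_cut_core {d w : Lattice} (hd : d ∈ core f (box z u v))
    (hw : w ∈ box z u (u + v)) (hc : StrictlyCuts f w d) : w = pt z u v 2 1 := by
  rw [box_shear] at hw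
  have hd := (mem_core_iff.1 hd).2
  rcases hw with rfl | rfl | rfl | rfl
  · exact absurd hc (hd _ (by rw [box_eq_pt]; simp))
  · exact absurd hc (hd _ (by rw [box_eq_pt]; simp))
  · exact absurd hc (hd _ (by rw [box_eq_pt]; simp))
  · rfl

theorem DiagCore.core_shear_subset (h : DiagCore f z u v) :
    core f (box z u (u + v)) ⊆ {pt z u v 0 0, pt z u v 1 1, pt z u v 2 1} := by
  intro w hw
  obtain ⟨hw1, hw2⟩ := mem_core_iff.1 hw
  have h0 := hw2 (pt z u v 0 0) (by rw [box_shear]; simp)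
  rw [box_shear] at hw1
  rcases hw1 with rfl | rfl | rfl | rfl
  · simp
  · exact absurd h.cut_left h0
  · simp
  · simp

theorem DiagCore.core_subset_shear (h : DiagCore f z u v) :
    core f (box z u v) ⊆ box z u (u + v) := by
  rw [h.core_eq, diag_eq_pt, box_shear]
  intro w; simp; tauto

theorem DiagCore.mem_core_shear (h : DiagCore f z u v) {d : Lattice}
    (hd : d ∈ core f (box z u v)) (hc : ¬ StrictlyCuts f (pt z u v 2 1) d) :
    d ∈ core f (box z u (u + v)) :=
  mem_core_iff.2 ⟨h.core_subset_shear hd, fun _ hw hwd => hc (eq_of_cut_core hd hw hwd ▸ hwd)⟩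

theorem DiagCore.prec_of_mem_core (hconv : ConvexOn ℝ Set.univ f) (hdiff : Differentiable ℝ f)
    (h : DiagCore f z u v) (hm : pt z u v 2 1 ∈ core f (box z u (u + v))) :
    Prec f (core f (box z u (u + v))) (core f (box z u v)) := by
  refine prec_of_mem h.core_subset_shear hm ?_ fun d hd w hw hc => ?_
  · rw [h.core_eq, diag_eq_pt]; simp [pt_eq_iff h.det]
  · obtain rfl := eq_of_cut_core hd hw hc
    exact hc.lt hconv hdiff

/-- Only `z` or `z + u` can cut the new vector, and `z` lies below `z + u`, which it cuts. -/
theorem DiagCore.lt_of_notMem_core (hconv : ConvexOn ℝ Set.univ f) (hdiff : Differentiable ℝ f)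
    (h : DiagCore f z u v) (hm : pt z u v 2 1 ∉ core f (box z u (u + v))) :
    f (emb (pt z u v 0 0)) < f (emb (pt z u v 2 1)) := by
  have : ∃ w ∈ box z u (u + v), StrictlyCuts f w (pt z u v 2 1) := by
    by_contra! hcon
    exact hm (mem_core_iff.2 ⟨by rw [box_shear]; simp, hcon⟩)
  obtain ⟨w, hw, hc⟩ := this
  rw [box_shear] at hw
  rcases hw with rfl | rfl | rfl | rfl
  · exact hc.lt hconv hdiff
  · exact (h.cut_left.lt hconv hdiff).trans (hc.lt hconv hdiff)
  · exact absurd hc (h.not_cut_right hconv hdiff)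
  · exact absurd hc (not_strictlyCuts_self _ _)

/-- If the new vector `z + 2u + v` enters the core, the core improves. Otherwise it lies above `z`
and cannot cut `z`. It cannot cut `z + u + v` either: that would leave at most `z` in the core,
contradicting the first two alternatives, and put `z` below `z + u + v`, contradicting the third. -/
theorem DiagCore.shear (hconv : ConvexOn ℝ Set.univ f) (hdiff : Differentiable ℝ f)
    (h : DiagCore f z u v)
    (hcond : IsConnectedSet f (box z u (u + v)) ∨
      core f (box z u (u + v)) = {pt z u v 2 1} ∨
      f (emb (pt z u v 1 1)) < f (emb (pt z u v 0 0))) :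
    Prec f (core f (box z u (u + v))) (core f (box z u v)) ∨
      core f (box z u (u + v)) = core f (box z u v) := by
  by_cases hm : pt z u v 2 1 ∈ core f (box z u (u + v))
  · exact Or.inl (h.prec_of_mem_core hconv hdiff hm)
  right
  have hlt := h.lt_of_notMem_core hconv hdiff hm
  have hn0 : ¬ StrictlyCuts f (pt z u v 2 1) (pt z u v 0 0) := fun hc =>
    lt_asymm hlt (hc.lt hconv hdiff)
  have hsub : core f (box z u (u + v)) ⊆ {pt z u v 0 0, pt z u v 1 1} := by
    intro w hw
    rcases h.core_shear_subset hw with rfl | rfl | rfl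
    · simp
    · simp
    · exact absurd hw hm
  by_cases hn1 : StrictlyCuts f (pt z u v 2 1) (pt z u v 1 1)
  · exfalso
    have hn1' : pt z u v 1 1 ∉ core f (box z u (u + v)) := fun hc =>
      (mem_core_iff.1 hc).2 _ (by rw [box_shear]; simp) hn1
    have hsub' : ∀ w ∈ core f (box z u (u + v)), w = pt z u v 0 0 := by
      intro w hw
      rcases hsub hw with rfl | rfl
      · rfl
      · exact absurd hw hn1'
    rcases hcond with hc | hc | hc
    · obtain ⟨a, ha, b, hb, hab⟩ := hc.exists_ne
      exact hab ((hsub' a ha).trans (hsub' b hb).symm)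
    · exact hm (by rw [hc]; rfl)
    · have := hn1.lt hconv hdiff
      linarith
  · apply Set.Subset.antisymm
    · rw [h.core_eq, diag_eq_pt]; exact hsub
    · rw [h.core_eq, diag_eq_pt]
      rintro w (rfl | rfl)
      · exact h.mem_core_shear h.mem.1 hn0
      · exact h.mem_core_shear h.mem.2 hn1

/-- If the sheared parallelogram is not connected, the new vector cuts the end of the diagonal. -/
theorem DiagCore.cut_of_not_connected (hconv : ConvexOn ℝ Set.univ f)
    (hdiff : Differentiable ℝ f) (h : DiagCore f z u v)
    (hcon : ¬ IsConnectedSet f (box z u (u + v))) :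
    StrictlyCuts f (pt z u v 2 1) (pt z u v 1 1) := by
  by_contra hn1
  -- The edges at `z + u + v` lead to `z` and to `z + 2u + v`, and `z + u` is cut. So as soon as one
  -- of these two joins `z + u + v` in the core, the sheared parallelogram is connected.
  have h11 := h.mem_core_shear h.mem.2 hn1
  have hdet : |det2 (u + v) u| = 1 := by
    have : det2 (u + v) u = - det2 u v := by simp only [det2, Pi.add_apply]; ring
    rw [this, abs_neg, h.det]
  have hbox1 : box z (u + v) u = box z u (u + v) := by
    rw [box, box, add_right_comm]
    ext w; simp only [Set.mem_insert_iff, Set.mem_singleton_iff]; tauto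
  have hdet2 : |det2 u (-(u + v))| = 1 := by
    have : det2 u (-(u + v)) = - det2 u v := by
      simp only [det2, Pi.add_apply, Pi.neg_apply]; ring
    rw [this, abs_neg, h.det]
  have e1 : pt z u v 1 1 + u = pt z u v 2 1 := by simp only [pt]; module
  have e2 : pt z u v 1 1 + -(u + v) = pt z u v 0 0 := by simp only [pt]; module
  have e3 : pt z u v 1 1 + u + -(u + v) = pt z u v 1 0 := by simp only [pt]; module
  have hbox2 : box (pt z u v 1 1) u (-(u + v)) = box z u (u + v) := by
    rw [box_shear, box, e3, e1, e2]
    ext w; simp only [Set.mem_insert_iff, Set.mem_singleton_iff]; tauto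
  have hsub := h.core_shear_subset
  by_cases h00 : pt z u v 0 0 ∈ core f (box z u (u + v))
  · by_cases h21 : pt z u v 2 1 ∈ core f (box z u (u + v))
    · have := isConnectedSet_of_triple (f := f) (z := pt z u v 1 1) hdet2 (by
        rw [hbox2, e1, e2]
        apply Set.Subset.antisymm
        · refine hsub.trans ?_
          intro w; simp; tauto
        · rintro w (rfl | rfl | rfl)
          exacts [h11, h21, h00])
      rw [hbox2] at this
      exact hcon this
    · have := isConnectedSet_of_pair (f := f) (z := z) hdet (by
        rw [hbox1, ← add_assoc, diag_eq_pt]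
        apply Set.Subset.antisymm
        · intro w hw
          rcases hsub hw with rfl | rfl | rfl
          · simp
          · simp
          · exact absurd hw h21
        · rintro w (rfl | rfl)
          exacts [h00, h11])
      rw [hbox1] at this
      exact hcon this
  · have hc : StrictlyCuts f (pt z u v 2 1) (pt z u v 0 0) := by
      by_contra hc
      exact h00 (h.mem_core_shear h.mem.1 hc)
    have h21 : pt z u v 2 1 ∈ core f (box z u (u + v)) := by
      by_contra hm
      exact lt_asymm (h.lt_of_notMem_core hconv hdiff hm) (hc.lt hconv hdiff)
    have := isConnectedSet_of_pair (f := f) (z := pt z u v 1 1) hdet2 (by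
      rw [hbox2, e1]
      apply Set.Subset.antisymm
      · intro w hw
        rcases hsub hw with rfl | rfl | rfl
        · exact absurd hw h00
        · simp
        · simp
      · rintro w (rfl | rfl)
        exacts [h11, h21])
    rw [hbox2] at this
    exact hcon this

theorem pt_reverse (z u v : Lattice) (a b : ℤ) :
    pt (z + u + v) (-u) (-v) a b = pt z u v (1 - a) (1 - b) := by
  simp only [pt]; module

theorem box_shear_reverse (z u v : Lattice) :
    box (z + u + v) (-u) (-u + -v) = box z (-u) (u + v) := by
  have e1 : z + u + v + -u = z + v := by abel
  have e2 : z + u + v + (-u + -v) = z := by abel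
  have e3 : z + u + v + -u + (-u + -v) = z - u := by abel
  have e4 : z + (u + v) = z + u + v := by abel
  have e5 : z + -u = z - u := by abel
  have e6 : z + -u + (u + v) = z + v := by abel
  rw [box, e3, e1, e2, box, e6, e4, e5]
  ext w; simp only [Set.mem_insert_iff, Set.mem_singleton_iff]; tauto

theorem box_reverse (z u v : Lattice) : box (z + u + v) (-u) (-v) = box z u v := by
  have e1 : z + u + v + -u = z + v := by abel
  have e2 : z + u + v + -v = z + u := by abel
  have e3 : z + u + v + -u + -v = z := by abel
  rw [box, e3, e1, e2, box]
  ext w; simp only [Set.mem_insert_iff, Set.mem_singleton_iff]; tauto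

theorem DiagCore.reverse (h : DiagCore f z u v) : DiagCore f (z + u + v) (-u) (-v) := by
  have e1 : z + u + v + -u = z + v := by abel
  have e2 : z + u + v + -v = z + u := by abel
  have e3 : z + u + v + -u + -v = z := by abel
  refine ⟨?_, ?_, ?_, ?_⟩
  · have : det2 (-u) (-v) = det2 u v := by simp only [det2, Pi.neg_apply]; ring
    rw [this, h.det]
  · rw [box_reverse, e3, h.core_eq, Set.pair_comm]
  · rw [e1]; exact h.right
  · rw [e3, e2]; exact h.left

/-- If neither sheared parallelogram is connected, the doubly sheared one improves the core. -/
theorem DiagCore.double (hconv : ConvexOn ℝ Set.univ f) (hdiff : Differentiable ℝ f)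
    (h : DiagCore f z u v) (hn1 : ¬ IsConnectedSet f (box z u (u + v)))
    (hn2 : ¬ IsConnectedSet f (box z (-u) (u + v)))
    (ht1 : StrictlyCuts f (pt z u v 1 1) (pt z u v (-1) 0) →
      ¬ StrictlyCuts f (pt z u v (-1) 0) z)
    (ht2 : StrictlyCuts f z (pt z u v 2 1) →
      ¬ StrictlyCuts f (pt z u v 2 1) (pt z u v 1 1)) :
    Prec f (core f (box z (-u) ((2 : ℤ) • u + v))) (core f (box z u v)) := by
  have k1 := h.cut_of_not_connected hconv hdiff hn1
  have k2 := h.reverse.cut_of_not_connected hconv hdiff (by rwa [box_shear_reverse])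
  have k3 := h.not_cut_right hconv hdiff
  have k4 := h.reverse.not_cut_right hconv hdiff
  simp only [pt_reverse] at k2 k4
  norm_num at k2 k4
  -- The two new vectors cut the ends of the diagonal, so the failed conditions of the table say
  -- that each end does not cut the opposite new vector. The near ones are not cut by `k3` and `k4`.
  have ht1 : ¬ StrictlyCuts f (pt z u v 1 1) (pt z u v (-1) 0) := fun hc =>
    ht1 hc (by rwa [pt_zero_zero] at k2)
  have ht2 : ¬ StrictlyCuts f (pt z u v 0 0) (pt z u v 2 1) := fun hc =>
    ht2 (by rwa [pt_zero_zero] at hc) k1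
  have e3 : z + ((2 : ℤ) • u + v) = pt z u v 2 1 := by simp only [pt]; module
  have e4 : z + -u + ((2 : ℤ) • u + v) = pt z u v 1 1 := by simp only [pt]; module
  have e5 : z + -u = pt z u v (-1) 0 := by simp only [pt]; module
  have hB : box z (-u) ((2 : ℤ) • u + v) =
      {pt z u v 0 0, pt z u v (-1) 0, pt z u v 2 1, pt z u v 1 1} := by
    rw [box, e4, e3, e5, pt_zero_zero]
  refine prec_of_not_cut hconv hdiff (box_finite ..) ?_ ⟨pt z u v 2 1, ?_, ?_⟩ ?_
  · rw [h.core_eq, diag_eq_pt, hB]; intro w; simp; tauto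
  · rw [hB]; simp
  · rw [h.core_eq, diag_eq_pt]; simp [pt_eq_iff h.det]
  · rw [h.core_eq, diag_eq_pt, hB]
    rintro c (rfl | rfl) w (rfl | rfl | rfl | rfl) hw <;>
      first | assumption | simp at hw

end

/-- The half-turn of the parallelogram exchanges the outcomes `U'` and `U''`, so one analysis of the
shear covers both. When the core is unchanged, the last clause records that the diagonal is now an
edge. -/
theorem prec_of_flip2 {f : Plane → ℝ} (hconv : ConvexOn ℝ Set.univ f)
    (hdiff : Differentiable ℝ f) {z : Lattice} {U V : Matrix (Fin 2) (Fin 2) ℤ}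
    (hU : |U.det| = 1) (hpre : Preprocessed f z U) (hV : Flip2 f z U V) :
    Prec f (core f (uset z V)) (core f (uset z U)) ∨
      (core f (uset z V) = core f (uset z U) ∧ |V.det| = 1 ∧
        V.col 1 = U.col 0 + U.col 1) := by
  rw [det_eq_det2] at hU
  obtain ⟨hcore, hV⟩ := hV
  obtain ⟨-, hpre, -⟩ := hpre
  simp only [Cond2', Cond2'', uset_cols] at hV
  rw [uset_eq_box] at hcore hpre
  rw [uset_eq_box _ U]
  set u := U.col 0
  set v := U.col 1
  have hD : DiagCore f z u v := by
    have hcard : (core f (box z u v)).encard = 2 := by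
      rw [hcore, diag_eq_pt]
      exact Set.encard_pair (by simp [pt_eq_iff hU])
    rcases hpre hcard with h | ⟨-, h1, h2⟩
    · exfalso
      have : pt z u v 1 0 ∈ core f (box z u v) := by rw [h, pair_eq_pt z u v]; simp
      rw [hcore, diag_eq_pt] at this
      simp [pt_eq_iff hU] at this
    · exact ⟨hU, hcore, h1, h2⟩
  have e21 : z + (2 : ℤ) • u + v = pt z u v 2 1 := by simp only [pt]; module
  have e11 : z + u + v = pt z u v 1 1 := by simp only [pt]; module
  have em : z - u = pt z u v (-1) 0 := by simp only [pt]; module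
  have hrev := pt_reverse z u v
  have hbox2 := box_shear_reverse z u v
  have hbox0 := box_reverse z u v
  rcases hV with ⟨hc, rfl⟩ | ⟨-, hc, rfl⟩ | ⟨hc1, hc2, rfl⟩
  · rw [uset_cols]
    refine (hD.shear hconv hdiff (hc.imp id (Or.imp ?_ ?_))).imp id
      fun h => ⟨h, ?_, cols_col_one _ _⟩
    · intro h; rw [h, e21]
    · rintro ⟨h1, h2⟩
      rw [pt_zero_zero, ← e11]
      exact (h1.lt hconv hdiff).trans (h2.lt hconv hdiff)
    · have : det2 u (u + v) = det2 u v := by simp only [det2, Pi.add_apply]; ring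
      rw [det_eq_det2, cols_col_zero, cols_col_one, this, hU]
  · rw [uset_cols]
    have := hD.reverse.shear hconv hdiff (by
      rw [hbox2, hrev, hrev, hrev]
      refine hc.imp id (Or.imp ?_ ?_)
      · intro h; rw [h, em]; norm_num
      · rintro ⟨h1, h2⟩
        norm_num
        rw [pt_zero_zero, ← e11]
        exact (h1.lt hconv hdiff).trans (h2.lt hconv hdiff))
    rw [hbox2, hbox0] at this
    refine this.imp id fun h => ⟨h, ?_, cols_col_one _ _⟩
    have : det2 (-u) (u + v) = - det2 u v := by
      simp only [det2, Pi.add_apply, Pi.neg_apply]; ring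
    rw [det_eq_det2, cols_col_zero, cols_col_one, this, abs_neg, hU]
  · rw [uset_cols]
    left
    push Not at hc1 hc2
    obtain ⟨hn1, -, ht1⟩ := hc1
    obtain ⟨hn2, -, ht2⟩ := hc2
    exact hD.double hconv hdiff hn1 hn2 (by rwa [em, e11] at ht1) (by rwa [e21, e11] at ht2)

/-! ### Improvements cannot continue forever -/

theorem finite_sublevel {f : Plane → ℝ}
    (hlevel : ∀ α : ℝ, Bornology.IsBounded {x : Plane | f x ≤ α}) (α : ℝ) :
    {w : Lattice | f (emb w) ≤ α}.Finite := by
  obtain ⟨R, hR⟩ := (hlevel α).exists_norm_le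
  refine (Set.finite_Icc (fun _ => -⌈R⌉ : Lattice) (fun _ => ⌈R⌉)).subset fun w hw => ?_
  have hj : ∀ j, |(w j : ℝ)| ≤ R := fun j => by
    have := PiLp.norm_apply_le (emb w) j
    exact this.trans (hR _ hw)
  constructor
  · intro j
    have h1 := (abs_le.1 (hj j)).1
    have h2 := Int.le_ceil R
    have : (-⌈R⌉ : ℝ) ≤ w j := by linarith
    exact_mod_cast this
  · intro j
    have h1 := (abs_le.1 (hj j)).2
    have h2 := Int.le_ceil R
    have : (w j : ℝ) ≤ ⌈R⌉ := by linarith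
    exact_mod_cast this

/-- Cores of bounded size cannot improve forever. -/
theorem not_forall_prec {f : Plane → ℝ} (hfin : ∀ α : ℝ, {w : Lattice | f (emb w) ≤ α}.Finite)
    (C : ℕ → Set Lattice) (N : ℕ) (hC : ∀ n, (C n).encard ≤ N)
    (hprec : ∀ n, Prec f (C (n + 1)) (C n)) : False := by
  choose r hr hrn hlt using hprec
  -- From some index on, no entering vector is below `t` and at least `j` core vectors have value at
  -- most `t`. For `j = N + 1` this is absurd.
  have key : ∀ j : ℕ, ∃ (t : ℝ) (I : ℕ), ∀ i, I ≤ i →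
      t ≤ f (emb (r i)) ∧ (j : ℕ∞) ≤ {w ∈ C i | f (emb w) ≤ t}.encard := by
    intro j
    induction j with
    | zero =>
      obtain ⟨I, hI⟩ : ∃ I, ∀ i, f (emb (r I)) ≤ f (emb (r i)) := by
        obtain ⟨w, ⟨⟨I, rfl⟩, -⟩, hw⟩ := exists_minimizer f
          (X := {w ∈ Set.range r | f (emb w) ≤ f (emb (r 0))})
          ((hfin (f (emb (r 0)))).subset fun w hw => hw.2) ⟨r 0, ⟨0, rfl⟩, le_rfl⟩
        refine ⟨I, fun i => ?_⟩
        by_cases h : f (emb (r i)) ≤ f (emb (r 0))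
        · exact hw _ ⟨⟨i, rfl⟩, h⟩
        · exact (hw _ ⟨⟨0, rfl⟩, le_rfl⟩).trans (le_of_not_ge h)
      exact ⟨f (emb (r I)), 0, fun i _ => ⟨hI i, by simp⟩⟩
    | succ j ih =>
      obtain ⟨t, I, h⟩ := ih
      -- The new threshold is the least value entering from index `I` on. Vectors up to this value
      -- are never dropped again, since a dropped vector lies above the one that enters; and `r s`
      -- is one more of them.
      obtain ⟨s, hs, hmin⟩ : ∃ s, I ≤ s ∧ ∀ i, I ≤ i → f (emb (r s)) ≤ f (emb (r i)) := by
        obtain ⟨w, ⟨⟨s, hs, rfl⟩, -⟩, hw⟩ := exists_minimizer f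
          (X := {w ∈ r '' Set.Ici I | f (emb w) ≤ f (emb (r I))})
          ((hfin (f (emb (r I)))).subset fun w hw => hw.2)
          ⟨r I, ⟨I, Set.self_mem_Ici, rfl⟩, le_rfl⟩
        refine ⟨s, hs, fun i hi => ?_⟩
        by_cases h : f (emb (r i)) ≤ f (emb (r I))
        · exact hw _ ⟨⟨i, hi, rfl⟩, h⟩
        · exact (hw _ ⟨⟨I, Set.self_mem_Ici, rfl⟩, le_rfl⟩).trans (le_of_not_ge h)
      have hkeep : ∀ i, I ≤ i → {w ∈ C i | f (emb w) ≤ f (emb (r s))} ⊆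
          {w ∈ C (i + 1) | f (emb w) ≤ f (emb (r s))} := by
        rintro i hi w ⟨hw, hws⟩
        refine ⟨?_, hws⟩
        by_contra hn
        have := hlt i w hw hn
        have := hmin i hi
        linarith
      refine ⟨f (emb (r s)), s + 1, fun i hi => ⟨hmin i (by omega), ?_⟩⟩
      induction i, hi using Nat.le_induction with
      | base =>
        have h1 : insert (r s) {w ∈ C s | f (emb w) ≤ f (emb (r s))} ⊆
            {w ∈ C (s + 1) | f (emb w) ≤ f (emb (r s))} :=
          Set.insert_subset ⟨hr s, le_rfl⟩ (hkeep s hs)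
        refine le_trans ?_ (Set.encard_le_encard h1)
        rw [Set.encard_insert_of_notMem fun hm => hrn s hm.1]
        push_cast
        gcongr
        refine (h s hs).2.trans (Set.encard_le_encard fun w hw => ⟨hw.1, hw.2.trans (h s hs).1⟩)
      | succ i hi ih => exact ih.trans (Set.encard_le_encard (hkeep i (by omega)))
  obtain ⟨t, I, h⟩ := key (N + 1)
  have h1 := ((h I le_rfl).2.trans (Set.encard_le_encard (Set.sep_subset _ _))).trans (hC I)
  have : N + 1 ≤ N := by exact_mod_cast h1
  omega

/-! ### Optimal vectors persist; without one, a case of the table applies -/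

theorem box_encard_le (z u v : Lattice) : (box z u v).encard ≤ 4 := by
  classical
  have : box z u v = (({z, z + u, z + v, z + u + v} : Finset Lattice) : Set Lattice) := by
    simp [box]
  rw [this, Set.encard_coe_eq_coe_finsetCard]
  exact_mod_cast Finset.card_le_four

theorem exists_lt_of_not_optimal {f : Plane → ℝ} {A : Set Lattice} (hfin : A.Finite)
    (hne : A.Nonempty) (hno : ¬ ∃ w ∈ A, IsOptimal f w) :
    ∃ x : Lattice, ∀ w ∈ A, f (emb x) < f (emb w) := by
  obtain ⟨r, hr, hmin⟩ := exists_minimizer f hfin hne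
  have : ¬ IsOptimal f r := fun h => hno ⟨r, hr, h⟩
  simp only [IsOptimal, not_forall, not_le] at this
  obtain ⟨x, hx⟩ := this
  exact ⟨x, fun w hw => hx.trans_le (hmin w hw)⟩

theorem isOptimal_of_gradient_eq_zero {f : Plane → ℝ} (hconv : ConvexOn ℝ Set.univ f)
    (hdiff : Differentiable ℝ f) {w : Lattice} (h : gradient f (emb w) = 0) :
    IsOptimal f w := fun v => by
  have := inner_gradient_le hconv hdiff (emb w) (emb v)
  simpa [h] using this

theorem core_subset_of_isFlip {f : Plane → ℝ} {z : Lattice} {U V : Matrix (Fin 2) (Fin 2) ℤ}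
    (h : IsFlip f z U V) : core f (uset z U) ⊆ uset z V := by
  rcases h with ⟨hc, rfl⟩ | ⟨hc, h⟩ | ⟨hc, i, -, -, k, -, rfl⟩ | ⟨hc, i, -, -, k, -, -, h⟩ |
    ⟨hc, i, -, -, h⟩
  · rw [hc, uset_cols]; rintro w rfl; simp [box]
  · rw [hc]
    rcases h with ⟨-, rfl⟩ | ⟨-, -, rfl⟩ | ⟨-, -, rfl⟩ <;> rw [uset_cols]
    · rintro w (rfl | rfl)
      · simp [box]
      · right; right; left; rw [add_assoc]
    · rintro w (rfl | rfl)
      · simp [box]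
      · right; right; left; rw [add_assoc]
    · rintro w (rfl | rfl)
      · simp [box]
      · right; right; right
        change _ = _
        module
  · rw [hc, uset_cols]
    rintro w (rfl | rfl)
    · simp [box]
    · right; right; right
      change _ = _
      module
  · rw [hc]
    rcases h with ⟨-, rfl⟩ | ⟨-, rfl⟩ <;> rw [uset_cols] <;> rintro w (rfl | rfl) <;> simp [box]
  · rw [hc]
    rcases h with ⟨-, rfl⟩ | ⟨-, rfl⟩ <;> rw [uset_cols] <;> rintro w (rfl | rfl | rfl)
    · simp [box]
    · simp [box]
    · right; right; right
      change _ = _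
      module
    · simp [box]
    · right; right; right
      change _ = _
      module
    · simp [box]

theorem core_subset_of_isUpdate {f : Plane → ℝ} {A B : Set Lattice} (h : IsUpdate f A B) :
    core f A ⊆ B := by
  rcases h with ⟨-, rfl⟩ | ⟨-, z, U, ⟨-, rfl⟩, -, ⟨V, hV, rfl⟩ | ⟨-, rfl⟩⟩
  · exact fun w hw => hw.1
  · exact core_subset_of_isFlip hV
  · exact fun w hw => hw.1

theorem IsOptimal.mem_core {f : Plane → ℝ} (hconv : ConvexOn ℝ Set.univ f)
    (hdiff : Differentiable ℝ f) {A : Set Lattice} {w : Lattice} (hw : w ∈ A)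
    (h : IsOptimal f w) : w ∈ core f A :=
  mem_core_iff.2 ⟨hw, fun a _ hc => absurd (hc.lt hconv hdiff) (not_lt.2 (h a))⟩

/-- If no case of the table applies, then there is no better vector. -/
theorem exists_isFlip {f : Plane → ℝ} (hconv : ConvexOn ℝ Set.univ f)
    (hdiff : Differentiable ℝ f) {z : Lattice} {U : Matrix (Fin 2) (Fin 2) ℤ}
    (hU : |U.det| = 1) (hpre : Preprocessed f z U)
    {x : Lattice} (hx : ∀ w ∈ uset z U, f (emb x) < f (emb w)) : ∃ V, IsFlip f z U V := by
  have hz : z ∈ core f (uset z U) := ⟨by rw [uset_eq_box]; simp [box], hpre.1⟩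
  have hU2 := hU
  rw [det_eq_det2] at hU2
  have hrow : z + U.col 0 ∈ core f (uset z U) →
      ∃ i : ℤ, (i = -1 ∨ i = 1) ∧ ∃ c : ℤ, pt z (U.col 0) (U.col 1) c i ∈ HZ f z U i := by
    intro h1
    rw [uset_eq_box] at hx hz h1
    obtain ⟨-, -, c, i, -, -, -, hi, -, -, -, -, -, hc⟩ :=
      exists_mem_intrGP hconv hdiff hU2 hz h1 hx
    exact ⟨i, hi, c, (mem_HZ_iff_box hU2).2 ⟨⟨c, rfl⟩, hc⟩⟩
  have hfin : (core f (uset z U)).Finite := by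
    rw [uset_eq_box]; exact (box_finite ..).subset fun w hw => hw.1
  have hle : (core f (uset z U)).encard ≤ 4 := by
    rw [uset_eq_box]
    exact (Set.encard_le_encard fun w hw => hw.1).trans (box_encard_le ..)
  have hge : 1 ≤ (core f (uset z U)).encard := Set.one_le_encard_iff_nonempty.2 ⟨z, hz⟩
  obtain ⟨n, hn⟩ : ∃ n : ℕ, (core f (uset z U)).encard = n := ⟨_, hfin.encard_eq_coe⟩
  have hn1 : 1 ≤ n := by rw [hn] at hge; exact_mod_cast hge
  have hn4 : n ≤ 4 := by rw [hn] at hle; exact_mod_cast hle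
  obtain rfl | rfl | rfl | rfl : n = 1 ∨ n = 2 ∨ n = 3 ∨ n = 4 := by omega
  · obtain ⟨w, hw⟩ := Set.encard_eq_one.1 (by exact_mod_cast hn)
    obtain rfl : z = w := by rw [hw] at hz; exact hz
    exact ⟨_, Or.inl ⟨hw, rfl⟩⟩
  · rcases hpre.2.1 (by exact_mod_cast hn) with hc | ⟨hc, -⟩
    · obtain ⟨i, hi, c, hcm⟩ := hrow (by rw [hc]; simp)
      rcases (Set.one_le_encard_iff_nonempty.2 ⟨_, hcm⟩ : 1 ≤ (HZ f z U i).encard).eq_or_lt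
        with h1 | h1
      · exact ⟨_, Or.inr (Or.inr (Or.inl ⟨hc, i, hi, h1.symm, c, hcm, rfl⟩))⟩
      · obtain ⟨k, hk, hmin⟩ := (measure Int.natAbs).wf.has_min
          {c : ℤ | pt z (U.col 0) (U.col 1) c i ∈ HZ f z U i} ⟨c, hcm⟩
        have hmin' : ∀ l : ℤ, z + l • U.col 0 + i • U.col 1 ∈ HZ f z U i → |k| ≤ |l| := by
          intro l hl
          have : ¬ l.natAbs < k.natAbs := hmin l hl
          rw [Int.abs_eq_natAbs, Int.abs_eq_natAbs]
          omega
        have h2 : 2 ≤ (HZ f z U i).encard := by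
          have := Order.add_one_le_of_lt h1
          rwa [one_add_one_eq_two] at this
        rcases le_or_gt 0 k with h0 | h0
        · exact ⟨_, Or.inr (Or.inr (Or.inr (Or.inl
            ⟨hc, i, hi, h2, k, hk, hmin', Or.inl ⟨h0, rfl⟩⟩)))⟩
        · exact ⟨_, Or.inr (Or.inr (Or.inr (Or.inl
            ⟨hc, i, hi, h2, k, hk, hmin', Or.inr ⟨by omega, rfl⟩⟩)))⟩
    · by_cases h1 : Cond2' f z U
      · exact ⟨_, Or.inr (Or.inl ⟨hc, Or.inl ⟨h1, rfl⟩⟩)⟩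
      by_cases h2 : Cond2'' f z U
      · exact ⟨_, Or.inr (Or.inl ⟨hc, Or.inr (Or.inl ⟨h1, h2, rfl⟩)⟩)⟩
      · exact ⟨_, Or.inr (Or.inl ⟨hc, Or.inr (Or.inr ⟨h1, h2, rfl⟩)⟩)⟩
  · have hc := hpre.2.2 (by exact_mod_cast hn)
    obtain ⟨i, hi, c, hcm⟩ := hrow (by rw [hc]; simp)
    have h1 : 1 ≤ (HZ f z U i).encard := Set.one_le_encard_iff_nonempty.2 ⟨_, hcm⟩
    rcases hi with rfl | rfl
    · exact ⟨_, Or.inr (Or.inr (Or.inr (Or.inr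
        ⟨hc, -1, Or.inl rfl, h1, Or.inr ⟨rfl, rfl⟩⟩)))⟩
    · exact ⟨_, Or.inr (Or.inr (Or.inr (Or.inr
        ⟨hc, 1, Or.inr rfl, h1, Or.inl ⟨rfl, rfl⟩⟩)))⟩
  · exfalso
    rw [uset_eq_box] at hx hn
    refine not_lt_of_core_eq hconv hdiff hU2 ?_ hx
    have hsub : core f (box z (U.col 0) (U.col 1)) ⊆ box z (U.col 0) (U.col 1) :=
      fun w hw => hw.1
    refine ((box_finite ..).subset hsub).eq_of_subset_of_encard_le hsub ?_
    rw [hn]; exact box_encard_le ..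

/-! ### The outcomes that need a second step -/

/-- A pair of vectors is not both an edge and a diagonal of a parallelogram. -/
theorem edge_ne_diag {z u v z' u' v' : Lattice} (h : |det2 u v| = 1) (h' : |det2 u' v'| = 1)
    (hbox : box z u v = box z' u' v') (hpair : ({z, z + u} : Set Lattice) = {z', z' + u' + v'}) :
    False := by
  obtain ⟨a, b, hv⟩ := exists_pt (z := 0) h' v
  have hv0 := (ne_zero_of_det2 h).2
  have hmem : ∀ c d : ℤ, pt z' u' v' c d ∈ box z u v → (c = 0 ∨ c = 1) ∧ (d = 0 ∨ d = 1) := by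
    intro c d hcd
    rw [hbox, box_eq_pt] at hcd
    simp only [Set.mem_insert_iff, Set.mem_singleton_iff, pt_eq_iff h'] at hcd
    omega
  have h1 : z + v ∈ box z u v := by simp [box]
  have h2 : z + u + v ∈ box z u v := by simp [box]
  have key : a = 0 ∧ b = 0 := by
    rcases Set.pair_eq_pair_iff.1 hpair with ⟨e1, e2⟩ | ⟨e1, e2⟩
    · have e3 : z + v = pt z' u' v' a b := by rw [e1, hv]; simp only [pt]; module
      have e4 : z + u + v = pt z' u' v' (1 + a) (1 + b) := by
        rw [e2, hv]; simp only [pt]; module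
      have := hmem a b (by rwa [← e3])
      have := hmem (1 + a) (1 + b) (by rwa [← e4])
      omega
    · have e3 : z + v = pt z' u' v' (1 + a) (1 + b) := by
        rw [e1, hv]; simp only [pt]; module
      have e4 : z + u + v = pt z' u' v' a b := by
        rw [e2, hv]; simp only [pt]; module
      have := hmem a b (by rwa [← e4])
      have := hmem (1 + a) (1 + b) (by rwa [← e3])
      omega
  obtain ⟨rfl, rfl⟩ := key
  exact hv0 (by rw [hv]; simp [pt])

/-- The edges of a parallelogram at a vertex are determined up to order. -/
theorem edges_of_box_eq {z u v u' v' : Lattice} (h : |det2 u v| = 1) (h' : |det2 u' v'| = 1)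
    (hbox : box z u v = box z u' v') : (u = u' ∧ v = v') ∨ (u = v' ∧ v = u') := by
  obtain ⟨a, b, hu⟩ := exists_pt (z := 0) h' u
  obtain ⟨c, d, hv⟩ := exists_pt (z := 0) h' v
  have hmem : ∀ c d : ℤ, pt z u' v' c d ∈ box z u v → (c = 0 ∨ c = 1) ∧ (d = 0 ∨ d = 1) := by
    intro c d hcd
    rw [hbox, box_eq_pt] at hcd
    simp only [Set.mem_insert_iff, Set.mem_singleton_iff, pt_eq_iff h'] at hcd
    omega
  have e1 : z + u = pt z u' v' a b := by rw [hu]; simp only [pt]; module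
  have e2 : z + v = pt z u' v' c d := by rw [hv]; simp only [pt]; module
  have e3 : z + u + v = pt z u' v' (a + c) (b + d) := by rw [hu, hv]; simp only [pt]; module
  have m1 := hmem a b (by rw [← e1]; simp [box])
  have m2 := hmem c d (by rw [← e2]; simp [box])
  have m3 := hmem (a + c) (b + d) (by rw [← e3]; simp [box])
  have n1 : ¬ (a = 0 ∧ b = 0) := by
    rintro ⟨rfl, rfl⟩
    exact (ne_zero_of_det2 h).1 (by rw [hu]; simp [pt])
  have n2 : ¬ (c = 0 ∧ d = 0) := by
    rintro ⟨rfl, rfl⟩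
    exact (ne_zero_of_det2 h).2 (by rw [hv]; simp [pt])
  have : (a = 1 ∧ b = 0 ∧ c = 0 ∧ d = 1) ∨ (a = 0 ∧ b = 1 ∧ c = 1 ∧ d = 0) := by omega
  rcases this with ⟨rfl, rfl, rfl, rfl⟩ | ⟨rfl, rfl, rfl, rfl⟩
  · left; exact ⟨by rw [hu]; simp [pt], by rw [hv]; simp [pt]⟩
  · right; exact ⟨by rw [hu]; simp [pt], by rw [hv]; simp [pt]⟩

/-- An update of a parallelogram without optimal vector is a flip. -/
theorem IsUpdate.exists_flip {f : Plane → ℝ} (hconv : ConvexOn ℝ Set.univ f)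
    (hdiff : Differentiable ℝ f) {A B : Set Lattice} (h : IsUpdate f A B)
    (hno : ¬ ∃ w ∈ A, IsOptimal f w) :
    ∃ z U V x, |Matrix.det U| = 1 ∧ A = uset z U ∧ Preprocessed f z U ∧ IsFlip f z U V ∧
      B = uset z V ∧ ∀ w ∈ uset z U, f (emb x) < f (emb w) := by
  rcases h with ⟨⟨w, hw, h0⟩, -⟩ | ⟨-, z, U, ⟨hU, rfl⟩, hpre, h⟩
  · exact absurd ⟨w, hw, isOptimal_of_gradient_eq_zero hconv hdiff h0⟩ hno
  · obtain ⟨x, hx⟩ := exists_lt_of_not_optimal (by rw [uset_eq_box]; exact box_finite ..)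
      ⟨z, by rw [uset_eq_box]; simp [box]⟩ hno
    rcases h with ⟨V, hV, hB⟩ | ⟨hn, -⟩
    · exact ⟨z, U, V, x, hU, rfl, hpre, hV, hB, hx⟩
    · obtain ⟨V, hV⟩ := exists_isFlip hconv hdiff hU hpre hx
      exact absurd hV (hn V)

/-- The step from a parallelogram whose only core vector cuts the second edge but not the first. -/
theorem mem_of_isUpdate_singleton {f : Plane → ℝ} (hconv : ConvexOn ℝ Set.univ f)
    (hdiff : Differentiable ℝ f) {z p q : Lattice} {B : Set Lattice} (hdet : |det2 p q| = 1)
    (hcore : core f (box z p q) = {z}) (hp : ¬ StrictlyCuts f z (z + p))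
    (hq : StrictlyCuts f z (z + q)) (h : IsUpdate f (box z p q) B)
    (hno : ¬ ∃ w ∈ box z p q, IsOptimal f w) : z + (p - q) ∈ B ∧ B.Finite := by
  obtain ⟨z', U, V, x, hU, hA, hpre, hV, rfl, hx⟩ := h.exists_flip hconv hdiff hno
  have hU2 := hU
  rw [det_eq_det2] at hU2
  refine ⟨?_, by rw [uset_eq_box]; exact box_finite ..⟩
  have hone : ∀ w ∈ core f (uset z' U), w = z := by
    rw [← hA, hcore]; exact fun w hw => hw
  have hz : z' = z := hone z' ⟨by rw [uset_eq_box]; simp [box], hpre.1⟩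
  subst hz
  have hu0 := (ne_zero_of_det2 hU2).1
  have hpair : ∀ s : Set Lattice, core f (uset z' U) = s → z' + U.col 0 ∈ s → False := by
    intro s hs hm
    have := hone (z' + U.col 0) (by rw [hs]; exact hm)
    exact hu0 (by simpa using this)
  have h1 : Flip1 f z' U V := by
    rcases hV with h | h | h | h | h
    · exact h
    · exfalso
      have h1 := hone (z' + U.col 0 + U.col 1) (by rw [h.1]; simp)
      have h2 : pt z' (U.col 0) (U.col 1) 1 1 = pt z' (U.col 0) (U.col 1) 0 0 := by
        rw [pt_one_one, pt_zero_zero, h1]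
      simp [pt_eq_iff hU2] at h2
    · exact (hpair _ h.1 (by simp)).elim
    · exact (hpair _ h.1 (by simp)).elim
    · exact (hpair _ h.1 (by simp)).elim
  obtain ⟨-, rfl⟩ := h1
  rw [strictlyCuts_add_iff] at hp hq
  have sp : sigma f z' p = 1 := by rw [sigma, if_pos (not_lt.1 hp)]
  have sq : sigma f z' q = -1 := by rw [sigma, if_neg (not_le.2 hq)]
  rw [uset_eq_box] at hA
  rw [uset_cols]
  -- The labelling may list the edges at `z` in either order. The signs `1` for `p` and `-1` for `q`
  -- make the opposite corner `z + (p - q)` in both.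
  rcases edges_of_box_eq hU2 hdet hA.symm with ⟨e1, e2⟩ | ⟨e1, e2⟩ <;> rw [e1, e2, sp, sq]
  · right; right; right
    change _ = _
    module
  · right; right; right
    change _ = _
    module

/-- Either an optimal vector is reached or the core improves after finitely many steps. -/
theorem exists_prec {f : Plane → ℝ} (hconv : ConvexOn ℝ Set.univ f)
    (hdiff : Differentiable ℝ f) {𝒰 : ℕ → Set Lattice}
    (hstep : ∀ i, IsUpdate f (𝒰 i) (𝒰 (i + 1)))
    (hno : ∀ i, ¬ ∃ w ∈ 𝒰 i, IsOptimal f w) (i : ℕ) :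
    ∃ j, Prec f (core f (𝒰 j)) (core f (𝒰 i)) := by
  have step : ∀ i, (∃ j, Prec f (core f (𝒰 j)) (core f (𝒰 i))) ∨
      ∃ z U V, |Matrix.det U| = 1 ∧ 𝒰 i = uset z U ∧ Flip2 f z U V ∧ 𝒰 (i + 1) = uset z V ∧
        core f (𝒰 (i + 1)) = core f (𝒰 i) ∧ |V.det| = 1 ∧ V.col 1 = U.col 0 + U.col 1 := by
    intro i
    obtain ⟨z, U, V, x, hU, hA, hpre, hV, hB, hx⟩ := (hstep i).exists_flip hconv hdiff (hno i)
    rcases hV with h | h | h | h | h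
    · left; exact ⟨i + 1, by rw [hA, hB]; exact prec_of_flip1 hconv hdiff hU h⟩
    · rcases prec_of_flip2 hconv hdiff hU hpre h with h' | h'
      · left; exact ⟨i + 1, by rw [hA, hB]; exact h'⟩
      · right; exact ⟨z, U, V, hU, hA, h, hB, by rw [hA, hB]; exact h'.1, h'.2⟩
    · left
      rcases prec_of_flip3 hconv hdiff hU h hx with h' | ⟨z', p, q, e, hdet, hc, hp, hq, hlt⟩
      · exact ⟨i + 1, by rw [hA, hB]; exact h'⟩
      · have hup := hstep (i + 1)
        have hno' := hno (i + 1)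
        rw [hB, e] at hup hno'
        obtain ⟨hm, hf⟩ := mem_of_isUpdate_singleton hconv hdiff hdet hc hp hq hup hno'
        exact ⟨i + 1 + 1, by rw [hA]; exact prec_of_lt hconv hdiff hf hm hlt⟩
    · left; exact ⟨i + 1, by rw [hA, hB]; exact prec_of_flip4 hconv hdiff hU h hx⟩
    · left; exact ⟨i + 1, by rw [hA, hB]; exact prec_of_flip5 hconv hdiff hU h⟩
  rcases step i with h | ⟨z, U, V, hU, hA, hF, hB, hcore, hV, hV1⟩
  · exact h
  rcases step (i + 1) with ⟨j, hj⟩ | ⟨z', U', -, hU', hA', ⟨hc', -⟩, -⟩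
  · exact ⟨j, hcore ▸ hj⟩
  -- Two successive flips of case 2 with an unchanged core would make the same pair an edge and a
  -- diagonal of one parallelogram.
  exfalso
  rw [hA, hF.1] at hcore
  rw [← hA', hcore] at hc'
  rw [hB, uset_eq_box, uset_eq_box] at hA'
  rw [det_eq_det2] at hV hU'
  have hdet : |det2 (V.col 1) (V.col 0)| = 1 := by
    have : det2 (V.col 1) (V.col 0) = - det2 (V.col 0) (V.col 1) := by simp only [det2]; ring
    rw [this, abs_neg, hV]
  have hbox : box z (V.col 1) (V.col 0) = box z (V.col 0) (V.col 1) := by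
    rw [box, box, add_right_comm]
    ext w; simp only [Set.mem_insert_iff, Set.mem_singleton_iff]; tauto
  refine edge_ne_diag hdet hU' (hbox.trans hA') ?_
  rw [hV1, ← add_assoc, hc']

end GradFlip

open GradFlip in
theorem mainTheorem4 (f : GradFlip.Plane → ℝ)
    (hconv : ConvexOn ℝ Set.univ f) (hdiff : Differentiable ℝ f)
    (hlevel : ∀ α : ℝ, Bornology.IsBounded {x : GradFlip.Plane | f x ≤ α})
    (𝒰 : ℕ → Set GradFlip.Lattice) (h0 : GradFlip.IsUnimodularSet (𝒰 0))
    (hstep : ∀ i : ℕ, GradFlip.IsUpdate f (𝒰 i) (𝒰 (i + 1))) :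
    ∃ T₁ : ℕ, ∀ i : ℕ, T₁ ≤ i → ∃ w ∈ 𝒰 i, GradFlip.IsOptimal f w := by
  suffices h : ∃ T₁ : ℕ, ∃ w ∈ 𝒰 T₁, IsOptimal f w by
    obtain ⟨T, w, hw, hopt⟩ := h
    refine ⟨T, fun i hi => ⟨w, ?_, hopt⟩⟩
    induction i, hi using Nat.le_induction with
    | base => exact hw
    | succ i _ ih =>
      exact core_subset_of_isUpdate (hstep i) (hopt.mem_core hconv hdiff ih)
  by_contra! hno
  have hno' : ∀ i, ¬ ∃ w ∈ 𝒰 i, IsOptimal f w := by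
    intro i ⟨w, hw, h⟩; exact hno i w hw h
  -- `g` sends an index to one with an improved core; the cores along the orbit of `0` under `g`
  -- improve at every step.
  choose g hg using exists_prec hconv hdiff hstep hno'
  refine not_forall_prec (finite_sublevel hlevel) (fun n => core f (𝒰 (g^[n] 0))) 4 (fun n => ?_)
    fun n => ?_
  · obtain ⟨z, U, -, -, -, hA, -⟩ :=
      (hstep (g^[n] 0)).exists_flip hconv hdiff (hno' _)
    rw [hA, uset_eq_box]
    have hsub : core f (box z (U.col 0) (U.col 1)) ⊆ box z (U.col 0) (U.col 1) :=
      fun w hw => hw.1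
    exact (Set.encard_le_encard hsub).trans (box_encard_le ..)
  · rw [Function.iterate_succ_apply']
    exact hg _
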